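/- Let $q\ge 2$ be a real number, and let $H_q(t)=\max(t^2,|t|^q)$ for $t\in\mathbb R$. Let $V:\mathbb R\to\mathbb R$ be a (Lebesgue measurable) function such that $d\mu(x)=e^{-V(x)}\,dx$ is a probability measure on $\mathbb R$. Assume that $V$ is locally bounded, that it is of class $C^2$ in neighbourhoods of $+\infty$ and of $-\infty$, and that (i) $\displaystyle\liminf_{|x|\to\infty}\operatorname{sign}(x)\,V'(x)>0$ (the value $+\infty$ is allowed); (ii) $\displaystyle\lim_{|x|\to\infty}\frac{V''(x)}{V'(x)^2}=0$. Then there exists a constant $\kappa<+\infty$ such that every locally Lipschitz function $f:\mathbb R\to\mathbb R$ satisfies $$\operatorname{Ent}_\mu(f^2)\le\kappa\int H_q\!\left(\frac{f'}{f}\right)f^2\,d\mu$$ if and only if $$\limsup_{|x|\to\infty}\frac{V(x)}{|V'(x)|^q}<\infty .$$ Here, for $g\ge 0$ measurable, $\operatorname{Ent}_\mu(g)=\int g\log g\,d\mu-\left(\int g\,d\mu\right)\log\left(\int g\,d\mu\right)$ if $g\log(1+g)$ is $\mu$-integrable and $\operatorname{Ent}_\mu(g)=+\infty$ otherwise. The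 right-hand integral takes values in $[0,+\infty]$, and its integrand is taken to be $0$ where $f=0$ (for locally Lipschitz $f$, almost every point with $f=0$ also has $f'=0$). -/

import Mathlib

open Filter Topology MeasureTheory
open scoped NNReal ENNReal

noncomputable section

/-- The function `H_q(t) = max (t², |t|^q)`. -/
def modifiedPower (q t : ℝ) : ℝ := max (t ^ 2) (|t| ^ q)

open Classical in
/-- The entropy `Ent_μ(g) = ∫ g log g dμ - (∫ g dμ) log (∫ g dμ)` of a non-negative function `g`
with respect to a probability measure `μ`, as an element of `[0, ∞]`. With the usual convention it
is `+∞` when `g log (1 + g)` is not integrable. Otherwise `g` and `g log g` are integrable and the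
difference is a non-negative real number by Jensen's inequality. -/
def boltzmannEntropy (μ : Measure ℝ) (g : ℝ → ℝ) : ℝ≥0∞ :=
  if Integrable (fun x => g x * Real.log (1 + g x)) μ then
    ENNReal.ofReal ((∫ x, g x * Real.log (g x) ∂μ) - (∫ x, g x ∂μ) * Real.log (∫ x, g x ∂μ))
  else ⊤

/-- The integral `∫ H_q(f'/f) f² dμ ∈ [0, ∞]`. The integrand is zero where `f` vanishes; for a
locally Lipschitz `f`, almost every zero of `f` is also a zero of `f'`. -/
def modifiedEnergy (q : ℝ) (μ : Measure ℝ) (f : ℝ → ℝ) : ℝ≥0∞ :=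
  ∫⁻ x, ENNReal.ofReal (modifiedPower q (deriv f x / f x) * f x ^ 2) ∂μ

/-- The measure `e^{-V(x)} dx` on the real line. -/
def gibbsMeasure (V : ℝ → ℝ) : Measure ℝ :=
  volume.withDensity fun x => ENNReal.ofReal (Real.exp (-V x))

end

/-!
Sufficiency. Normalise `∫ f² dμ = 1`, so that the entropy is at most `∫ klFun (f²) dμ`. Since
`V' ≥ c > 0` on the tails, integrating by parts against `e^{-V}` gives a Poincaré inequality, and a
pointwise bound `f² e^{-V} ≤ 2 + M` there with `M` of the order of the energy. Hence `klFun (f²)` is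
controlled where `|f| < 2`, while `log f² ≤ V + 1 + M` where `|f| ≥ 2`, and only the integrals of
`f² V` over the tails remain. As `V e^{-V} = -(V / V') (e^{-V})'`, a second integration by parts,
against the field `V / V'`, bounds them: `|V''| ≤ θ V'²` with `θ < 1` absorbs the derivative of the
field, and Young's inequality with `V ≤ C V'^q` turns the derivative of `f²` into `H_q(f'/f) f²`.
To avoid an additive constant, `f²` is replaced by a weight comparable to it where `|f| ≥ 2` but
flat where `|f| = 1`.

Necessity. Test the inequality on `min (V - V a) 1 ^ m` on `[a, ∞)`, extended by `0`. The energy is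
of order at most `V'(a)^(q-1) e^{-V(a)}` and the mass of its square is at least of order
`e^{-V(a)} / V'(a)`. The entropy is at least this mass times `-log μ(a, ∞) ≥ V(a) + log c`, by
Jensen's inequality on the support. Comparing the two sides gives `V(a) ≲ V'(a)^q`.
-/

open Set

/-! ### Locally Lipschitz functions on the line -/

section LocallyLipschitz

variable {f : ℝ → ℝ}

theorem locallyLipschitz_absolutelyContinuousOnInterval (hf : LocallyLipschitz f) (a b : ℝ) :
    AbsolutelyContinuousOnInterval f a b := by
  obtain ⟨K, hK⟩ :=
    (hf.locallyLipschitzOn (s := uIcc a b)).exists_lipschitzOnWith_of_compact isCompact_uIcc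
  exact hK.absolutelyContinuousOnInterval

theorem absolutelyContinuousOnInterval_of_contDiffAt {ψ : ℝ → ℝ} {a b : ℝ}
    (hψ : ∀ x, a ≤ x → ContDiffAt ℝ 1 ψ x) (hab : a ≤ b) : AbsolutelyContinuousOnInterval ψ a b :=
  ContDiffOn.absolutelyContinuousOnInterval fun x hx =>
    (hψ x (by rw [uIcc_of_le hab] at hx; exact hx.1)).contDiffWithinAt

theorem locallyLipschitz_ae_differentiableAt (hf : LocallyLipschitz f) :
    ∀ᵐ x, DifferentiableAt ℝ f x := by
  have hIcc : ∀ n : ℕ, ∀ᵐ x : ℝ, x ∈ uIcc (-(n : ℝ)) n → DifferentiableAt ℝ f x := fun n =>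
    (locallyLipschitz_absolutelyContinuousOnInterval hf _ _).ae_differentiableAt
  filter_upwards [ae_all_iff.2 hIcc] with x hx
  obtain ⟨n, hn⟩ := exists_nat_ge |x|
  exact hx n (Icc_subset_uIcc (abs_le.1 hn))

theorem locallyLipschitz_contDiff_comp {g : ℝ → ℝ} (hg : ContDiff ℝ 1 g)
    (hf : LocallyLipschitz f) : LocallyLipschitz fun x => g (f x) :=
  hg.locallyLipschitz.comp hf

theorem countable_setOf_eq_zero_deriv_ne_zero (f : ℝ → ℝ) :
    {x | f x = 0 ∧ deriv f x ≠ 0}.Countable := by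
  have : DiscreteTopology {x | f x = 0 ∧ deriv f x ≠ 0} := by
    rw [discreteTopology_subtype_iff]
    rintro x ⟨-, hx'⟩
    have hne := (differentiableAt_of_deriv_ne_zero hx').hasDerivAt.eventually_ne (c := 0) hx'
    refine disjoint_iff.1 (Filter.disjoint_principal_right.2 ?_)
    filter_upwards [hne] with y hy using fun h => hy h.1
  exact countable_coe_iff.1 countable_of_Lindelof_of_discrete

theorem ae_deriv_eq_zero_of_eq_zero (f : ℝ → ℝ) : ∀ᵐ x, f x = 0 → deriv f x = 0 := by
  filter_upwards [(countable_setOf_eq_zero_deriv_ne_zero f).ae_notMem volume] with x hx hfx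
  exact of_not_not fun hne => hx ⟨hfx, hne⟩

theorem sq_lintegral_le_measure_univ_mul_lintegral_sq {α : Type*} {_ : MeasurableSpace α}
    {μ : Measure α} {g : α → ℝ≥0∞} (hg : AEMeasurable g μ) :
    (∫⁻ x, g x ∂μ) ^ 2 ≤ μ univ * ∫⁻ x, g x ^ 2 ∂μ := by
  have holder := ENNReal.lintegral_mul_le_Lp_mul_Lq μ Real.HolderConjugate.two_two
    (aemeasurable_const (b := (1 : ℝ≥0∞))) hg
  simp only [Pi.mul_apply, one_mul, lintegral_const, ENNReal.rpow_ofNat] at holder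
  refine (pow_le_pow_left' holder 2).trans_eq ?_
  simp only [mul_pow, ← ENNReal.rpow_natCast, ← ENNReal.rpow_mul]
  norm_num

theorem ofReal_sub_sq_le_mul_lintegral_deriv_sq (hf : LocallyLipschitz f) {a b x y : ℝ}
    (hx : x ∈ Icc a b) (hy : y ∈ Icc a b) :
    ENNReal.ofReal ((f x - f y) ^ 2) ≤
      ENNReal.ofReal (b - a) * ∫⁻ z in Icc a b, ENNReal.ofReal (deriv f z ^ 2) := by
  have hfund := (locallyLipschitz_absolutelyContinuousOnInterval hf y x).integral_deriv_eq_sub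
  have hnorm : ‖f x - f y‖ₑ ≤ ∫⁻ z in Icc a b, ‖deriv f z‖ₑ := by
    rw [← hfund, ← ofReal_norm, intervalIntegral.norm_intervalIntegral_eq, ofReal_norm]
    exact (enorm_integral_le_lintegral_enorm _).trans
      (lintegral_mono_set (uIoc_subset_uIcc.trans (uIcc_subset_Icc hy hx)))
  have hsq : ∀ t : ℝ, ENNReal.ofReal (t ^ 2) = ‖t‖ₑ ^ 2 := fun t => by
    rw [← enorm_pow, Real.enorm_of_nonneg (sq_nonneg t)]
  simp only [hsq]
  refine (pow_le_pow_left' hnorm 2).trans ?_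
  have := sq_lintegral_le_measure_univ_mul_lintegral_sq (μ := volume.restrict (Icc a b))
    (measurable_deriv f).enorm.aemeasurable
  rwa [Measure.restrict_apply_univ, Real.volume_Icc] at this

end LocallyLipschitz

theorem ofReal_add_setLIntegral_Ioc_le {a b : ℝ} (hab : a ≤ b) {F u w : ℝ → ℝ}
    (hF : AbsolutelyContinuousOnInterval F a b) (hFb : 0 ≤ F b) (hu : AEMeasurable u volume)
    (hu0 : ∀ x ∈ Icc a b, 0 ≤ u x) (hw0 : ∀ x ∈ Icc a b, 0 ≤ w x)
    (h : ∀ᵐ x, x ∈ Icc a b → deriv F x + w x ≤ u x) :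
    ENNReal.ofReal (F b) + ∫⁻ x in Ioc a b, ENNReal.ofReal (w x) ≤
      ENNReal.ofReal (F a) + ∫⁻ x in Ioc a b, ENNReal.ofReal (u x) := by
  have hmem : ∀ᵐ x ∂volume.restrict (Ioc a b), x ∈ Icc a b :=
    (ae_restrict_mem measurableSet_Ioc).mono fun _ hx => Ioc_subset_Icc_self hx
  have hu0' : 0 ≤ᵐ[volume.restrict (Ioc a b)] u := hmem.mono hu0
  rcases eq_or_ne (∫⁻ x in Ioc a b, ENNReal.ofReal (u x)) ⊤ with htop | htop
  · simp [htop]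
  have hui : IntegrableOn u (Ioc a b) :=
    ⟨hu.aestronglyMeasurable.restrict,
      by rwa [hasFiniteIntegral_iff_ofReal hu0', lt_top_iff_ne_top]⟩
  have hFi : IntegrableOn (deriv F) (Ioc a b) := hF.intervalIntegrable_deriv.1
  have hle : ∀ᵐ x ∂volume.restrict (Ioc a b), w x ≤ (u - deriv F) x := by
    filter_upwards [hmem, ae_restrict_of_ae h] with x hx hxw
    exact le_sub_iff_add_le'.2 (hxw hx)
  have hdiff0 : 0 ≤ᵐ[volume.restrict (Ioc a b)] u - deriv F := by
    filter_upwards [hmem, hle] with x hx hxw using (hw0 x hx).trans hxw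
  have hint : ∫ x in Ioc a b, (u - deriv F) x = (∫ x in Ioc a b, u x) + F a - F b := by
    rw [integral_sub' hui hFi, ← intervalIntegral.integral_of_le hab (f := deriv F),
      hF.integral_deriv_eq_sub]
    ring
  calc ENNReal.ofReal (F b) + ∫⁻ x in Ioc a b, ENNReal.ofReal (w x)
    _ ≤ ENNReal.ofReal (F b) + ENNReal.ofReal (∫ x in Ioc a b, (u - deriv F) x) := by
      rw [ofReal_integral_eq_lintegral_ofReal (hui.sub hFi) hdiff0]
      exact add_le_add le_rfl
        (lintegral_mono_ae (hle.mono fun _ hx => ENNReal.ofReal_le_ofReal hx))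
    _ = ENNReal.ofReal (F a + ∫ x in Ioc a b, u x) := by
      rw [← ENNReal.ofReal_add hFb (integral_nonneg_of_ae hdiff0), hint]
      ring_nf
    _ ≤ _ := by
      rw [← ofReal_integral_eq_lintegral_ofReal hui hu0']
      exact ENNReal.ofReal_add_le

/-! ### Gibbs measures -/

section GibbsMeasure

variable {V : ℝ → ℝ}

theorem setLIntegral_gibbsMeasure (hV : AEMeasurable V volume) (k : ℝ → ℝ≥0∞) {s : Set ℝ}
    (hs : MeasurableSet s) :
    ∫⁻ x in s, k x ∂gibbsMeasure V = ∫⁻ x in s, k x * ENNReal.ofReal (Real.exp (-V x)) := by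
  have hdens : AEMeasurable (fun x => ENNReal.ofReal (Real.exp (-V x))) volume :=
    (Real.measurable_exp.comp_aemeasurable hV.neg).ennreal_ofReal
  rw [gibbsMeasure, restrict_withDensity hs, lintegral_withDensity_eq_lintegral_mul_non_measurable₀
    _ hdens.restrict (.of_forall fun _ => ENNReal.ofReal_lt_top)]
  simp only [Pi.mul_apply, mul_comm]

theorem ae_gibbsMeasure {p : ℝ → Prop} (h : ∀ᵐ x, p x) : ∀ᵐ x ∂gibbsMeasure V, p x :=
  (withDensity_absolutelyContinuous _ _).ae_le h

theorem ofReal_add_setLIntegral_Ioc_gibbsMeasure_le (hV : AEMeasurable V volume) {a b : ℝ}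
    (hab : a ≤ b) {F u w : ℝ → ℝ} (hF : AbsolutelyContinuousOnInterval F a b) (hFb : 0 ≤ F b)
    (hu : AEMeasurable u volume) (hu0 : ∀ x ∈ Icc a b, 0 ≤ u x) (hw0 : ∀ x ∈ Icc a b, 0 ≤ w x)
    (h : ∀ᵐ x, x ∈ Icc a b → deriv F x + w x * Real.exp (-V x) ≤ u x * Real.exp (-V x)) :
    ENNReal.ofReal (F b) + ∫⁻ x in Ioc a b, ENNReal.ofReal (w x) ∂gibbsMeasure V ≤
      ENNReal.ofReal (F a) + ∫⁻ x in Ioc a b, ENNReal.ofReal (u x) ∂gibbsMeasure V := by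
  simp only [setLIntegral_gibbsMeasure hV _ measurableSet_Ioc,
    ← ENNReal.ofReal_mul' (Real.exp_nonneg _)]
  exact ofReal_add_setLIntegral_Ioc_le hab hF hFb
    (hu.mul (Real.measurable_exp.comp_aemeasurable hV.neg))
    (fun x hx => mul_nonneg (hu0 x hx) (Real.exp_nonneg _))
    (fun x hx => mul_nonneg (hw0 x hx) (Real.exp_nonneg _)) h

end GibbsMeasure

/-! ### Regular tails -/

/-- A right tail of a potential: `V` is `C²` near `[R, ∞)`, where it is non-negative, with slope at
least `c > 0` and with `V''` dominated by `V'²`. The conditions `V' > 0` and `V''/V'² → 0` at `+∞`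
are encoded by the constants `c > 0` and `θ < 1`. -/
structure IsRegularTail (V : ℝ → ℝ) (R c θ : ℝ) : Prop where
  pos : 0 < c
  lt_one : θ < 1
  contDiffOn : ∃ S < R, ContDiffOn ℝ 2 V (Ioi S)
  nonneg : ∀ x, R ≤ x → 0 ≤ V x
  le_deriv : ∀ x, R ≤ x → c ≤ deriv V x
  abs_deriv_deriv_le : ∀ x, R ≤ x → |deriv (deriv V) x| ≤ θ * deriv V x ^ 2

namespace IsRegularTail

variable {V : ℝ → ℝ} {R c θ : ℝ}

theorem mono (h : IsRegularTail V R c θ) {R' : ℝ} (hR : R ≤ R') : IsRegularTail V R' c θ where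
  pos := h.pos
  lt_one := h.lt_one
  contDiffOn := let ⟨S, hS, hV⟩ := h.contDiffOn; ⟨S, hS.trans_le hR, hV⟩
  nonneg x hx := h.nonneg x (hR.trans hx)
  le_deriv x hx := h.le_deriv x (hR.trans hx)
  abs_deriv_deriv_le x hx := h.abs_deriv_deriv_le x (hR.trans hx)

theorem deriv_pos (h : IsRegularTail V R c θ) {x : ℝ} (hx : R ≤ x) : 0 < deriv V x :=
  h.pos.trans_le (h.le_deriv x hx)

theorem contDiffAt (h : IsRegularTail V R c θ) {x : ℝ} (hx : R ≤ x) : ContDiffAt ℝ 2 V x := by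
  obtain ⟨S, hS, hV⟩ := h.contDiffOn
  exact hV.contDiffAt (Ioi_mem_nhds (hS.trans_le hx))

theorem contDiffAt_deriv (h : IsRegularTail V R c θ) {x : ℝ} (hx : R ≤ x) :
    ContDiffAt ℝ 1 (deriv V) x := by
  obtain ⟨S, hS, hV⟩ := h.contDiffOn
  exact (hV.deriv_of_isOpen isOpen_Ioi (by norm_num)).contDiffAt (Ioi_mem_nhds (hS.trans_le hx))

theorem hasDerivAt (h : IsRegularTail V R c θ) {x : ℝ} (hx : R ≤ x) :
    HasDerivAt V (deriv V x) x :=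
  ((h.contDiffAt hx).differentiableAt (by norm_num)).hasDerivAt

theorem hasDerivAt_deriv (h : IsRegularTail V R c θ) {x : ℝ} (hx : R ≤ x) :
    HasDerivAt (deriv V) (deriv (deriv V) x) x :=
  ((h.contDiffAt_deriv hx).differentiableAt (by norm_num)).hasDerivAt

theorem hasDerivAt_exp_neg (h : IsRegularTail V R c θ) {x : ℝ} (hx : R ≤ x) :
    HasDerivAt (fun x => Real.exp (-V x)) (-deriv V x * Real.exp (-V x)) x := by
  simpa [mul_comm] using (h.hasDerivAt hx).neg.exp

theorem continuousOn (h : IsRegularTail V R c θ) : ContinuousOn V (Ici R) :=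
  fun _ hx => (h.hasDerivAt hx).continuousAt.continuousWithinAt

theorem strictMonoOn (h : IsRegularTail V R c θ) : StrictMonoOn V (Ici R) :=
  strictMonoOn_of_deriv_pos (convex_Ici R) h.continuousOn fun _ hx =>
    h.deriv_pos (interior_subset hx)

theorem absolutelyContinuousOnInterval_exp_neg (h : IsRegularTail V R c θ) {b : ℝ} (hb : R ≤ b) :
    AbsolutelyContinuousOnInterval (fun x => Real.exp (-V x)) R b :=
  absolutelyContinuousOnInterval_of_contDiffAt
    (fun _ hx => ((h.contDiffAt hx).of_le (by norm_num)).neg.exp) hb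

theorem ofReal_add_setLIntegral_Ioc_le (h : IsRegularTail V R c θ) (hV : AEMeasurable V volume)
    {g u w : ℝ → ℝ} {b : ℝ} (hb : R ≤ b) (hg : AbsolutelyContinuousOnInterval g R b)
    (hgb : 0 ≤ g b) (hu : AEMeasurable u volume) (hu0 : ∀ x, R ≤ x → 0 ≤ u x)
    (hw0 : ∀ x, R ≤ x → 0 ≤ w x)
    (hle : ∀ᵐ x, R ≤ x → deriv g x - g x * deriv V x + w x ≤ u x) :
    ENNReal.ofReal (g b * Real.exp (-V b)) + ∫⁻ x in Ioc R b, ENNReal.ofReal (w x) ∂gibbsMeasure V ≤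
      ENNReal.ofReal (g R * Real.exp (-V R)) +
        ∫⁻ x in Ioc R b, ENNReal.ofReal (u x) ∂gibbsMeasure V := by
  refine ofReal_add_setLIntegral_Ioc_gibbsMeasure_le hV hb
    (hg.mul (h.absolutelyContinuousOnInterval_exp_neg hb)) (mul_nonneg hgb (Real.exp_nonneg _)) hu
    (fun x hx => hu0 x hx.1) (fun x hx => hw0 x hx.1) ?_
  filter_upwards [hg.ae_differentiableAt, hle] with x hgx hx hmem
  rw [((hgx (by rwa [uIcc_of_le hb])).hasDerivAt.mul (h.hasDerivAt_exp_neg hmem.1)).deriv]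
  linarith [mul_le_mul_of_nonneg_right (hx hmem.1) (Real.exp_nonneg (-V x))]

theorem setLIntegral_Ioi_le (h : IsRegularTail V R c θ) (hV : AEMeasurable V volume)
    {g u w : ℝ → ℝ} (hg : ∀ b, R ≤ b → AbsolutelyContinuousOnInterval g R b)
    (hg0 : ∀ b, R ≤ b → 0 ≤ g b) (hu : AEMeasurable u volume) (hu0 : ∀ x, R ≤ x → 0 ≤ u x)
    (hw : AEMeasurable w volume) (hw0 : ∀ x, R ≤ x → 0 ≤ w x)
    (hle : ∀ᵐ x, R ≤ x → deriv g x - g x * deriv V x + w x ≤ u x) :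
    ∫⁻ x in Ioi R, ENNReal.ofReal (w x) ∂gibbsMeasure V ≤
      ENNReal.ofReal (g R * Real.exp (-V R)) +
        ∫⁻ x in Ioi R, ENNReal.ofReal (u x) ∂gibbsMeasure V := by
  have hw' : AEMeasurable (fun x => ENNReal.ofReal (w x)) ((gibbsMeasure V).restrict (Ioi R)) :=
    (hw.mono_ac (withDensity_absolutelyContinuous _ _)).ennreal_ofReal.restrict
  refine le_of_tendsto
    ((aecover_Iic tendsto_id).lintegral_tendsto_of_countably_generated hw') ?_
  filter_upwards [eventually_ge_atTop R] with b hb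
  rw [Measure.restrict_restrict measurableSet_Iic, inter_comm, Ioi_inter_Iic]
  calc ∫⁻ x in Ioc R b, ENNReal.ofReal (w x) ∂gibbsMeasure V
    _ ≤ ENNReal.ofReal (g b * Real.exp (-V b)) +
        ∫⁻ x in Ioc R b, ENNReal.ofReal (w x) ∂gibbsMeasure V := le_add_self
    _ ≤ ENNReal.ofReal (g R * Real.exp (-V R)) +
        ∫⁻ x in Ioc R b, ENNReal.ofReal (u x) ∂gibbsMeasure V :=
      h.ofReal_add_setLIntegral_Ioc_le hV hb (hg b hb) (hg0 b hb) hu hu0 hw0 hle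
    _ ≤ _ := by
      gcongr
      exact Ioc_subset_Ioi_self

theorem lintegral_sub_sq_le (h : IsRegularTail V R c θ) (hV : AEMeasurable V volume) {f : ℝ → ℝ}
    (hf : LocallyLipschitz f) :
    ∫⁻ x in Ioi R, ENNReal.ofReal ((f x - f R) ^ 2) ∂gibbsMeasure V ≤
      ENNReal.ofReal (4 / c ^ 2) *
        ∫⁻ x in Ioi R, ENNReal.ofReal (deriv f x ^ 2) ∂gibbsMeasure V := by
  have hc := h.pos
  have hfm := hf.continuous.measurable
  have hg : LocallyLipschitz fun x => 2 / c * (f x - f R) ^ 2 :=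
    locallyLipschitz_contDiff_comp (g := fun s => 2 / c * (s - f R) ^ 2) (by fun_prop) hf
  rw [← lintegral_const_mul' _ _ ENNReal.ofReal_ne_top]
  simp only [← ENNReal.ofReal_mul (show 0 ≤ 4 / c ^ 2 by positivity)]
  refine (h.setLIntegral_Ioi_le hV (u := fun x => 4 / c ^ 2 * deriv f x ^ 2)
    (fun b _ => locallyLipschitz_absolutelyContinuousOnInterval hg R b)
    (fun b _ => by positivity) ((measurable_deriv f).pow_const 2 |>.const_mul _).aemeasurable
    (fun x _ => by positivity) (by fun_prop) (fun x _ => sq_nonneg _) ?_).trans_eq (by simp)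
  filter_upwards [locallyLipschitz_ae_differentiableAt hf] with x hfx hx
  have hderiv : deriv (fun x => 2 / c * (f x - f R) ^ 2) x =
      2 / c * (2 * (f x - f R) * deriv f x) := by
    simpa using (((hfx.hasDerivAt.sub_const (f R)).fun_pow 2).const_mul (2 / c)).deriv
  have hslope : 2 * (f x - f R) ^ 2 ≤ 2 / c * (f x - f R) ^ 2 * deriv V x := by
    calc 2 * (f x - f R) ^ 2 = 2 / c * (f x - f R) ^ 2 * c := by field
      _ ≤ _ := by gcongr; exact h.le_deriv x hx
  have hsquare : 4 / c ^ 2 * deriv f x ^ 2 - 2 / c * (2 * (f x - f R) * deriv f x) +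
      (f x - f R) ^ 2 = (2 / c * deriv f x - (f x - f R)) ^ 2 := by ring
  rw [hderiv]
  linarith [sq_nonneg (2 / c * deriv f x - (f x - f R))]

theorem ofReal_sq_mul_exp_neg_le (h : IsRegularTail V R c θ) (hV : AEMeasurable V volume)
    {f : ℝ → ℝ} (hf : LocallyLipschitz f) {x : ℝ} (hx : R ≤ x) :
    ENNReal.ofReal (f x ^ 2 * Real.exp (-V x)) ≤ ENNReal.ofReal (f R ^ 2 * Real.exp (-V R)) +
      ENNReal.ofReal (1 / c) * ∫⁻ x in Ioi R, ENNReal.ofReal (deriv f x ^ 2) ∂gibbsMeasure V := by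
  have hc := h.pos
  have hg : LocallyLipschitz fun x => f x ^ 2 :=
    locallyLipschitz_contDiff_comp (g := fun s => s ^ 2) (by fun_prop) hf
  rw [← lintegral_const_mul' _ _ ENNReal.ofReal_ne_top]
  simp only [← ENNReal.ofReal_mul (show 0 ≤ 1 / c by positivity)]
  refine (le_self_add.trans (h.ofReal_add_setLIntegral_Ioc_le hV hx (w := 0)
    (locallyLipschitz_absolutelyContinuousOnInterval hg R x) (sq_nonneg _)
    ((measurable_deriv f).pow_const 2 |>.const_mul (1 / c)).aemeasurable
    (fun x _ => by positivity) (fun _ _ => le_rfl) ?_)).trans ?_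
  · filter_upwards [locallyLipschitz_ae_differentiableAt hf] with y hfy hy
    have hderiv : deriv (fun x => f x ^ 2) y = 2 * f y * deriv f y := by
      simpa using (hfy.hasDerivAt.fun_pow 2).deriv
    have hslope := mul_le_mul_of_nonneg_left (h.le_deriv y hy) (sq_nonneg (f y))
    have hsquare : 1 / c * deriv f y ^ 2 - 2 * f y * deriv f y + f y ^ 2 * c =
        1 / c * (deriv f y - c * f y) ^ 2 := by field
    have : 0 ≤ 1 / c * (deriv f y - c * f y) ^ 2 := by positivity
    rw [hderiv, Pi.zero_apply]
    linarith
  · gcongr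
    exact Ioc_subset_Ioi_self

theorem lintegral_deriv_le (h : IsRegularTail V R c θ) (hV : AEMeasurable V volume) :
    ∫⁻ x in Ioi R, ENNReal.ofReal (deriv V x) ∂gibbsMeasure V ≤
      ENNReal.ofReal (Real.exp (-V R)) := by
  refine (h.setLIntegral_Ioi_le hV (g := fun _ => 1) (u := 0)
    (fun b _ => locallyLipschitz_absolutelyContinuousOnInterval (.const 1) R b)
    (fun _ _ => zero_le_one) aemeasurable_const (fun _ _ => le_rfl)
    (measurable_deriv V).aemeasurable (fun x hx => (h.deriv_pos hx).le) ?_).trans_eq (by simp)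
  exact .of_forall fun x _ => by simp

theorem mul_gibbsMeasure_Ioi_le (h : IsRegularTail V R c θ) (hV : AEMeasurable V volume) :
    ENNReal.ofReal c * gibbsMeasure V (Ioi R) ≤ ENNReal.ofReal (Real.exp (-V R)) := by
  rw [← setLIntegral_const]
  refine (setLIntegral_mono' measurableSet_Ioi fun x hx => ?_).trans (h.lintegral_deriv_le hV)
  exact ENNReal.ofReal_le_ofReal (h.le_deriv x (le_of_lt hx))

end IsRegularTail

/-! ### A quadratic weight which is flat at `±1` -/

section FlatWeight

theorem sq_le_modifiedPower (q t : ℝ) : t ^ 2 ≤ modifiedPower q t := le_max_left _ _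

theorem rpow_le_modifiedPower (q t : ℝ) : |t| ^ q ≤ modifiedPower q t := le_max_right _ _

theorem modifiedPower_nonneg (q t : ℝ) : 0 ≤ modifiedPower q t :=
  (sq_nonneg t).trans (sq_le_modifiedPower q t)

theorem measurable_modifiedPower (q : ℝ) : Measurable (modifiedPower q) := by
  unfold modifiedPower
  fun_prop

theorem measurable_modifiedPower_deriv_div_mul_sq (q : ℝ) {f : ℝ → ℝ} (hf : Continuous f) :
    Measurable fun x => modifiedPower q (deriv f x / f x) * f x ^ 2 :=
  ((measurable_modifiedPower q).comp ((measurable_deriv f).div hf.measurable)).mul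
    (hf.measurable.pow_const 2)

/-- A weight of quadratic growth which vanishes to order `2m` at `±1`. It replaces `s²` when a
normalised function is integrated against the potential: since it is at most `2(|s| - 1)²`, its
integral is controlled by the Poincaré inequality. For `2m ≥ q` its derivative can still be absorbed
by Young's inequality with exponent `q`. -/
noncomputable def flatWeight (m : ℕ) (s : ℝ) : ℝ :=
  (1 + s ^ 2) * ((s ^ 2 - 1) / (1 + s ^ 2)) ^ (2 * m)

theorem contDiff_flatWeight (m : ℕ) : ContDiff ℝ 1 (flatWeight m) := by
  have h (s : ℝ) : 1 + s ^ 2 ≠ 0 := by positivity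
  unfold flatWeight
  fun_prop (disch := exact h _)

theorem flatWeight_nonneg (m : ℕ) (s : ℝ) : 0 ≤ flatWeight m s := by
  rw [flatWeight, pow_mul]
  positivity

theorem abs_sq_sub_one_div_le (s : ℝ) : |(s ^ 2 - 1) / (1 + s ^ 2)| ≤ 1 := by
  rw [abs_div, abs_of_pos (by positivity : 0 < 1 + s ^ 2), div_le_one (by positivity), abs_le]
  constructor <;> linarith [sq_nonneg s]

theorem sq_mul_pow_le_flatWeight (m : ℕ) (s : ℝ) :
    s ^ 2 * |(s ^ 2 - 1) / (1 + s ^ 2)| ^ (2 * m) ≤ flatWeight m s := by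
  rw [flatWeight, pow_mul, sq_abs, ← pow_mul]
  refine mul_le_mul_of_nonneg_right (by linarith) ?_
  rw [pow_mul]
  positivity

theorem flatWeight_le {m : ℕ} (hm : m ≠ 0) (s : ℝ) : flatWeight m s ≤ 2 * (|s| - 1) ^ 2 := by
  have hpos : 0 < 1 + s ^ 2 := by positivity
  have hpow : ((s ^ 2 - 1) / (1 + s ^ 2)) ^ (2 * m) ≤ ((s ^ 2 - 1) / (1 + s ^ 2)) ^ 2 := by
    rw [pow_mul]
    exact pow_le_of_le_one (sq_nonneg _)
      ((sq_le_one_iff_abs_le_one _).2 (abs_sq_sub_one_div_le s)) hm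
  calc flatWeight m s ≤ (1 + s ^ 2) * ((s ^ 2 - 1) / (1 + s ^ 2)) ^ 2 := by
        unfold flatWeight; gcongr
    _ = (|s| - 1) ^ 2 * ((|s| + 1) ^ 2 / (1 + s ^ 2)) := by
        rw [← sq_abs s] at hpos ⊢
        field
    _ ≤ (|s| - 1) ^ 2 * 2 := by
        gcongr
        rw [div_le_iff₀ hpos, ← sq_abs s]
        linarith [sq_nonneg (|s| - 1)]
    _ = _ := mul_comm _ _

theorem sq_le_mul_flatWeight (m : ℕ) {s : ℝ} (hs : 2 ≤ |s|) :
    s ^ 2 ≤ (5 / 3) ^ (2 * m) * flatWeight m s := by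
  have hsq : 4 ≤ s ^ 2 := by rw [← sq_abs]; nlinarith
  have hbase : 1 ≤ 5 / 3 * ((s ^ 2 - 1) / (1 + s ^ 2)) := by
    rw [← mul_div_assoc, le_div_iff₀ (by positivity)]
    linarith
  calc s ^ 2 ≤ (1 + s ^ 2) * 1 := by linarith
    _ ≤ (1 + s ^ 2) * (5 / 3 * ((s ^ 2 - 1) / (1 + s ^ 2))) ^ (2 * m) := by
        gcongr
        exact one_le_pow₀ hbase
    _ = _ := by rw [flatWeight, mul_pow]; ring

theorem deriv_flatWeight {m : ℕ} (hm : m ≠ 0) (s : ℝ) :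
    deriv (flatWeight m) s = 2 * s * ((s ^ 2 - 1) / (1 + s ^ 2)) ^ (2 * m - 1) *
      ((s ^ 2 - 1) / (1 + s ^ 2) + 4 * m / (1 + s ^ 2)) := by
  have hpos : 1 + s ^ 2 ≠ 0 := by positivity
  have hnum : HasDerivAt (fun s : ℝ => s ^ 2 - 1) (2 * s) s := by
    simpa using (hasDerivAt_pow 2 s).sub_const 1
  have hden : HasDerivAt (fun s : ℝ => 1 + s ^ 2) (2 * s) s := by
    simpa using (hasDerivAt_pow 2 s).const_add 1
  refine (hden.mul ((hnum.div hden hpos).fun_pow (2 * m))).deriv.trans ?_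
  obtain ⟨k, hk⟩ : ∃ k, 2 * m = k + 1 := ⟨2 * m - 1, by omega⟩
  have hmk : (m : ℝ) = (k + 1) / 2 := by
    rw [eq_div_iff two_ne_zero, mul_comm]
    exact_mod_cast hk
  simp only [Pi.div_apply, hk, Nat.add_sub_cancel, pow_succ _ k, Nat.cast_add, Nat.cast_one, hmk]
  field

theorem abs_deriv_flatWeight_mul_le {m : ℕ} (hm : m ≠ 0) (s t : ℝ) :
    |deriv (flatWeight m) s * t| ≤
      s ^ 2 * ((2 + 8 * m) * |t / s| * |(s ^ 2 - 1) / (1 + s ^ 2)| ^ (2 * m - 1)) := by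
  have hfactor : |(s ^ 2 - 1) / (1 + s ^ 2) + 4 * m / (1 + s ^ 2)| ≤ 1 + 4 * (m : ℝ) := by
    refine (abs_add_le _ _).trans (add_le_add (abs_sq_sub_one_div_le s) ?_)
    rw [abs_of_nonneg (by positivity)]
    exact div_le_self (by positivity) (by linarith [sq_nonneg s])
  have hst : |s| * |t| = s ^ 2 * |t / s| := by
    rcases eq_or_ne s 0 with rfl | hs
    · simp
    · rw [abs_div, ← sq_abs s]
      have := abs_ne_zero.2 hs
      field
  calc |deriv (flatWeight m) s * t|
    _ = 2 * (|s| * |t|) * |(s ^ 2 - 1) / (1 + s ^ 2)| ^ (2 * m - 1) *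
          |(s ^ 2 - 1) / (1 + s ^ 2) + 4 * m / (1 + s ^ 2)| := by
        rw [deriv_flatWeight hm, abs_mul, abs_mul, abs_mul, abs_mul, abs_pow, abs_two]
        ring
    _ ≤ 2 * (s ^ 2 * |t / s|) * |(s ^ 2 - 1) / (1 + s ^ 2)| ^ (2 * m - 1) * (1 + 4 * m) := by
        rw [hst]
        gcongr
    _ = _ := by ring

theorem lintegral_ofReal_const_mul_add_const_mul {α : Type*} {_ : MeasurableSpace α}
    (μ : Measure α) {a b : ℝ} (ha : 0 ≤ a) (hb : 0 ≤ b) {g k : α → ℝ} (hg : Measurable g)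
    (hg0 : ∀ x, 0 ≤ g x) (hk0 : ∀ x, 0 ≤ k x) :
    ∫⁻ x, ENNReal.ofReal (a * g x + b * k x) ∂μ =
      ENNReal.ofReal a * ∫⁻ x, ENNReal.ofReal (g x) ∂μ +
        ENNReal.ofReal b * ∫⁻ x, ENNReal.ofReal (k x) ∂μ := by
  rw [← lintegral_const_mul' _ _ ENNReal.ofReal_ne_top,
    ← lintegral_const_mul' _ _ ENNReal.ofReal_ne_top, ← lintegral_add_left (by fun_prop)]
  refine lintegral_congr fun x => ?_
  rw [ENNReal.ofReal_add (mul_nonneg ha (hg0 x)) (mul_nonneg hb (hk0 x)),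
    ENNReal.ofReal_mul ha, ENNReal.ofReal_mul hb]

theorem mul_pow_mul_rpow_le {q e v y ε : ℝ} {n : ℕ} (hq : 1 ≤ q) (hn : q ≤ n + 1) (he0 : 0 ≤ e)
    (he1 : e ≤ 1) (hv : 0 ≤ v) (hy : 0 ≤ y) (hε : 0 < ε) :
    y * e ^ n * v ^ (q - 1) ≤ ε * (e ^ (n + 1) * v ^ q) + ε * (y / ε) ^ q := by
  have hsplit {a : ℝ} (ha : 0 ≤ a) : a ^ q = a * a ^ (q - 1) := by
    rw [← Real.rpow_one_add' ha (by linarith), add_sub_cancel]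
  rcases le_total y (ε * (e * v)) with h | h
  · calc y * e ^ n * v ^ (q - 1) ≤ ε * (e * v) * e ^ n * v ^ (q - 1) := by gcongr
      _ = ε * (e ^ (n + 1) * v ^ q) := by rw [hsplit hv]; ring
      _ ≤ _ := le_add_of_nonneg_right (by positivity)
  · have hpow : e ^ n ≤ e ^ (q - 1) := by
      rw [← Real.rpow_natCast]
      exact Real.rpow_le_rpow_of_exponent_ge_of_imp he0 he1 (by linarith) fun _ h0 => by
        linarith [Nat.cast_nonneg (α := ℝ) n]
    calc y * e ^ n * v ^ (q - 1) ≤ y * (e ^ (q - 1) * v ^ (q - 1)) := by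
          rw [mul_assoc]; gcongr
      _ = y * (e * v) ^ (q - 1) := by rw [Real.mul_rpow he0 hv]
      _ ≤ y * (y / ε) ^ (q - 1) := by
          gcongr
          rwa [le_div_iff₀' hε]
      _ = ε * (y / ε) ^ q := by rw [hsplit (by positivity)]; field
      _ ≤ _ := le_add_of_nonneg_left (by positivity)

theorem deriv_flatWeight_mul_le {q K v φ ε : ℝ} {m : ℕ} (hq : 1 ≤ q) (hm : q ≤ 2 * m)
    (hK : 0 ≤ K) (hv : 0 ≤ v) (hφ0 : 0 ≤ φ) (hφ : φ ≤ K * v ^ (q - 1)) (hε : 0 < ε) (s t : ℝ) :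
    deriv (flatWeight m) s * t * φ ≤ ε * (flatWeight m s * v ^ q) +
      ε * ((2 + 8 * m) * K / ε) ^ q * (modifiedPower q (t / s) * s ^ 2) := by
  have hm0 : m ≠ 0 := by
    rintro rfl
    norm_num at hm
    linarith
  obtain ⟨n, hn⟩ : ∃ n, 2 * m = n + 1 := ⟨2 * m - 1, by omega⟩
  have hnq : q ≤ n + 1 := hm.trans_eq (by exact_mod_cast hn)
  set η := (s ^ 2 - 1) / (1 + s ^ 2)
  have hslope : |deriv (flatWeight m) s * t| ≤ s ^ 2 * ((2 + 8 * m) * |t / s| * |η| ^ n) := by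
    simpa [hn] using abs_deriv_flatWeight_mul_le hm0 s t
  have hpower : ((2 + 8 * m) * K * |t / s| / ε) ^ q ≤
      ((2 + 8 * m) * K / ε) ^ q * modifiedPower q (t / s) := by
    rw [mul_div_right_comm, Real.mul_rpow (by positivity) (abs_nonneg _)]
    gcongr
    exact rpow_le_modifiedPower q _
  have hweight : s ^ 2 * |η| ^ (n + 1) ≤ flatWeight m s := hn ▸ sq_mul_pow_le_flatWeight m s
  calc deriv (flatWeight m) s * t * φ
    _ ≤ |deriv (flatWeight m) s * t| * φ := by gcongr; exact le_abs_self _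
    _ ≤ s ^ 2 * ((2 + 8 * m) * |t / s| * |η| ^ n) * (K * v ^ (q - 1)) := by gcongr
    _ = s ^ 2 * ((2 + 8 * m) * K * |t / s| * |η| ^ n * v ^ (q - 1)) := by ring
    _ ≤ s ^ 2 * (ε * (|η| ^ (n + 1) * v ^ q) + ε * ((2 + 8 * m) * K * |t / s| / ε) ^ q) := by
        gcongr
        exact mul_pow_mul_rpow_le hq hnq (abs_nonneg η) (abs_sq_sub_one_div_le s) hv
          (by positivity) hε
    _ ≤ s ^ 2 * (ε * (|η| ^ (n + 1) * v ^ q) +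
          ε * (((2 + 8 * m) * K / ε) ^ q * modifiedPower q (t / s))) := by gcongr
    _ = ε * (s ^ 2 * |η| ^ (n + 1) * v ^ q) +
          ε * ((2 + 8 * m) * K / ε) ^ q * (modifiedPower q (t / s) * s ^ 2) := by ring
    _ ≤ _ := by gcongr

theorem div_le_mul_rpow_of_le_mul_rpow {q C p v : ℝ} (hq : 1 ≤ q) (hC : 0 ≤ C) (hp : 0 < p)
    (hv : 0 ≤ v) (h : v ≤ C * p ^ q) : v / p ≤ C ^ (1 / q) * (v ^ (1 / q)) ^ (q - 1) := by
  have hroot : v ^ (1 / q) ≤ C ^ (1 / q) * p := by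
    refine (Real.rpow_le_rpow hv h (by positivity)).trans_eq ?_
    rw [Real.mul_rpow hC (by positivity), ← Real.rpow_mul hp.le,
      mul_one_div_cancel (by linarith), Real.rpow_one]
  rw [div_le_iff₀ hp]
  calc v = v ^ (1 / q) * (v ^ (1 / q)) ^ (q - 1) := by
        rw [← Real.rpow_one_add' (by positivity) (by linarith), add_sub_cancel,
          ← Real.rpow_mul hv, one_div_mul_cancel (by linarith), Real.rpow_one]
    _ ≤ C ^ (1 / q) * p * (v ^ (1 / q)) ^ (q - 1) := by gcongr
    _ = _ := by ring

end FlatWeight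

namespace IsRegularTail

variable {V : ℝ → ℝ} {R c θ : ℝ}

theorem hasDerivAt_div_deriv (h : IsRegularTail V R c θ) {x : ℝ} (hx : R ≤ x) :
    HasDerivAt (fun x => V x / deriv V x) (1 - V x * (deriv (deriv V) x / deriv V x ^ 2)) x := by
  have hne := (h.deriv_pos hx).ne'
  convert! (h.hasDerivAt hx).div (h.hasDerivAt_deriv hx) hne using 1
  field

theorem contDiffAt_div_deriv (h : IsRegularTail V R c θ) {x : ℝ} (hx : R ≤ x) :
    ContDiffAt ℝ 1 (fun x => V x / deriv V x) x :=
  ((h.contDiffAt hx).of_le (by norm_num)).div (h.contDiffAt_deriv hx) (h.deriv_pos hx).ne'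

theorem neg_le_deriv_deriv_div_sq (h : IsRegularTail V R c θ) {x : ℝ} (hx : R ≤ x) :
    -θ ≤ deriv (deriv V) x / deriv V x ^ 2 := by
  rw [le_div_iff₀ (pow_pos (h.deriv_pos hx) 2)]
  linarith [neg_abs_le (deriv (deriv V) x), h.abs_deriv_deriv_le x hx]

theorem deriv_flatWeight_mul_div_le (h : IsRegularTail V R c θ) {q C : ℝ} {m : ℕ} (hq : 1 ≤ q)
    (hm : q ≤ 2 * m) (hC : 0 ≤ C) {x : ℝ} (hx : R ≤ x) (hVq : V x ≤ C * deriv V x ^ q) (s t : ℝ) :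
    deriv (flatWeight m) s * t * (V x / deriv V x) +
        flatWeight m s * (1 - V x * (deriv (deriv V) x / deriv V x ^ 2)) -
        flatWeight m s * V x + (1 - θ) / 2 * (flatWeight m s * V x) ≤
      flatWeight m s + (1 - θ) / 2 * ((2 + 8 * m) * C ^ (1 / q) / ((1 - θ) / 2)) ^ q *
        (modifiedPower q (t / s) * s ^ 2) := by
  have hVx := h.nonneg x hx
  have hV'x := h.deriv_pos hx
  have hδ : 0 < (1 - θ) / 2 := by linarith [h.lt_one]
  have hyoung := deriv_flatWeight_mul_le hq hm (by positivity) (by positivity)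
    (by positivity) (div_le_mul_rpow_of_le_mul_rpow hq hC hV'x hVx hVq) hδ s t
  rw [← Real.rpow_mul hVx, one_div_mul_cancel (by linarith), Real.rpow_one] at hyoung
  have hcurv := mul_le_mul_of_nonneg_left (h.neg_le_deriv_deriv_div_sq hx)
    (mul_nonneg (flatWeight_nonneg m s) hVx)
  linarith

theorem deriv_flatWeight_comp_mul_div_le (h : IsRegularTail V R c θ) {q C : ℝ} {m : ℕ} (hq : 1 ≤ q)
    (hm : q ≤ 2 * m) (hC : 0 ≤ C) {x : ℝ} (hx : R ≤ x) (hVq : V x ≤ C * deriv V x ^ q)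
    {f : ℝ → ℝ} (hfx : DifferentiableAt ℝ f x) :
    deriv (fun x => 2 / (1 - θ) * (flatWeight m (f x) * (V x / deriv V x))) x -
        2 / (1 - θ) * (flatWeight m (f x) * (V x / deriv V x)) * deriv V x +
        flatWeight m (f x) * V x ≤
      2 / (1 - θ) * flatWeight m (f x) + ((2 + 8 * m) * C ^ (1 / q) / ((1 - θ) / 2)) ^ q *
        (modifiedPower q (deriv f x / f x) * f x ^ 2) := by
  have hθ : 0 < 1 - θ := by linarith [h.lt_one]
  have hcomp : HasDerivAt (fun x => flatWeight m (f x)) (deriv (flatWeight m) (f x) * deriv f x)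
      x := ((contDiff_flatWeight m).differentiable one_ne_zero _).hasDerivAt.comp x hfx.hasDerivAt
  have hderiv := ((hcomp.fun_mul (h.hasDerivAt_div_deriv hx)).const_mul (2 / (1 - θ))).deriv
  have hne := (h.deriv_pos hx).ne'
  have hmul := mul_le_mul_of_nonneg_left
    (h.deriv_flatWeight_mul_div_le hq hm hC hx hVq (f x) (deriv f x))
    (show 0 ≤ 2 / (1 - θ) by positivity)
  rw [hderiv]
  refine le_trans (le_of_eq ?_) (hmul.trans_eq ?_)
  · field
  · field

theorem setLIntegral_flatWeight_mul_le (h : IsRegularTail V R c θ) (hV : AEMeasurable V volume)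
    {q C : ℝ} {m : ℕ} (hq : 1 ≤ q) (hm : q ≤ 2 * m) (hC : 0 ≤ C)
    (hVq : ∀ x, R ≤ x → V x ≤ C * deriv V x ^ q) {f : ℝ → ℝ} (hf : LocallyLipschitz f) :
    ∫⁻ x in Ioi R, ENNReal.ofReal (flatWeight m (f x) * V x) ∂gibbsMeasure V ≤
      ENNReal.ofReal (2 / (1 - θ) * (V R / deriv V R) * Real.exp (-V R) * flatWeight m (f R)) +
      (ENNReal.ofReal (2 / (1 - θ)) * ∫⁻ x, ENNReal.ofReal (flatWeight m (f x)) ∂gibbsMeasure V +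
      ENNReal.ofReal (((2 + 8 * m) * C ^ (1 / q) / ((1 - θ) / 2)) ^ q) *
        modifiedEnergy q (gibbsMeasure V) f) := by
  set D := ((2 + 8 * m) * C ^ (1 / q) / ((1 - θ) / 2)) ^ q
  have hθ : 0 < 1 - θ := by linarith [h.lt_one]
  have hD : 0 ≤ D := by positivity
  have hψ := contDiff_flatWeight m
  have hΨf := locallyLipschitz_contDiff_comp hψ hf
  have hΨm : Measurable fun x => flatWeight m (f x) := hΨf.continuous.measurable
  have hΨ0 := flatWeight_nonneg m
  have hEm := measurable_modifiedPower_deriv_div_mul_sq q hf.continuous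
  have hE0 (x : ℝ) : 0 ≤ modifiedPower q (deriv f x / f x) * f x ^ 2 :=
    mul_nonneg (modifiedPower_nonneg q _) (sq_nonneg _)
  refine (h.setLIntegral_Ioi_le hV
    (g := fun x => 2 / (1 - θ) * (flatWeight m (f x) * (V x / deriv V x)))
    (u := fun x => 2 / (1 - θ) * flatWeight m (f x) +
      D * (modifiedPower q (deriv f x / f x) * f x ^ 2))
    (fun b hb => ((locallyLipschitz_absolutelyContinuousOnInterval hΨf R b).mul
      (absolutelyContinuousOnInterval_of_contDiffAt
        (fun x hx => h.contDiffAt_div_deriv hx) hb)).const_mul _)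
    (fun b hb => ?_) (by fun_prop)
    (fun x _ => add_nonneg (mul_nonneg (by positivity) (hΨ0 _)) (mul_nonneg hD (hE0 x)))
    (hΨm.aemeasurable.mul hV) (fun x hx => mul_nonneg (hΨ0 _) (h.nonneg x hx)) ?_).trans ?_
  · have := h.nonneg b hb
    have := h.deriv_pos hb
    have := hΨ0 (f b)
    positivity
  · filter_upwards [locallyLipschitz_ae_differentiableAt hf] with x hfx hx
    exact h.deriv_flatWeight_comp_mul_div_le hq hm hC hx (hVq x hx) hfx
  · rw [modifiedEnergy,
      ← lintegral_ofReal_const_mul_add_const_mul _ (by positivity) hD hΨm (fun x => hΨ0 _) hE0]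
    refine add_le_add (ENNReal.ofReal_le_ofReal (le_of_eq ?_)) (setLIntegral_le_lintegral _ _)
    ring

end IsRegularTail

/-! ### Reflection -/

section Reflection

theorem measurePreserving_neg_gibbsMeasure (V : ℝ → ℝ) :
    MeasurePreserving Neg.neg (gibbsMeasure fun x => V (-x)) (gibbsMeasure V) where
  measurable := measurable_neg
  map_eq := by
    ext s hs
    rw [Measure.map_apply measurable_neg hs, gibbsMeasure, gibbsMeasure, withDensity_apply _ hs,
      withDensity_apply _ (measurable_neg hs)]
    exact (Measure.measurePreserving_neg volume).setLIntegral_comp_preimage_emb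
      (MeasurableEquiv.neg ℝ).measurableEmbedding (fun x => ENNReal.ofReal (Real.exp (-V x))) s

theorem lintegral_gibbsMeasure_comp_neg (V : ℝ → ℝ) (g : ℝ → ℝ≥0∞) :
    ∫⁻ x, g (-x) ∂gibbsMeasure (fun x => V (-x)) = ∫⁻ x, g x ∂gibbsMeasure V :=
  (measurePreserving_neg_gibbsMeasure V).lintegral_comp_emb
    (MeasurableEquiv.neg ℝ).measurableEmbedding g

theorem setLIntegral_Ioi_gibbsMeasure_comp_neg (V : ℝ → ℝ) (g : ℝ → ℝ≥0∞) (R : ℝ) :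
    ∫⁻ x in Ioi R, g (-x) ∂gibbsMeasure (fun x => V (-x)) =
      ∫⁻ x in Iio (-R), g x ∂gibbsMeasure V := by
  rw [← (measurePreserving_neg_gibbsMeasure V).setLIntegral_comp_preimage_emb
    (MeasurableEquiv.neg ℝ).measurableEmbedding g]
  simp

theorem isProbabilityMeasure_gibbsMeasure_comp_neg {V : ℝ → ℝ}
    (h : IsProbabilityMeasure (gibbsMeasure V)) :
    IsProbabilityMeasure (gibbsMeasure fun x => V (-x)) where
  measure_univ := by
    rw [← h.measure_univ, ← (measurePreserving_neg_gibbsMeasure V).measure_preimage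
      nullMeasurableSet_univ, preimage_univ]

theorem aemeasurable_comp_neg {V : ℝ → ℝ} (hV : AEMeasurable V volume) :
    AEMeasurable (fun x => V (-x)) volume :=
  hV.comp_quasiMeasurePreserving (Measure.measurePreserving_neg volume).quasiMeasurePreserving

theorem locallyLipschitz_comp_neg {f : ℝ → ℝ} (hf : LocallyLipschitz f) :
    LocallyLipschitz fun x => f (-x) :=
  hf.comp (ContDiff.locallyLipschitz (𝕂 := ℝ) contDiff_neg)

theorem modifiedPower_neg (q t : ℝ) : modifiedPower q (-t) = modifiedPower q t := by
  simp only [modifiedPower, even_two, Even.neg_pow, abs_neg]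

theorem modifiedEnergy_comp_neg (q : ℝ) (V f : ℝ → ℝ) :
    modifiedEnergy q (gibbsMeasure fun x => V (-x)) (fun x => f (-x)) =
      modifiedEnergy q (gibbsMeasure V) f := by
  rw [modifiedEnergy, modifiedEnergy, ← lintegral_gibbsMeasure_comp_neg V
    fun x => ENNReal.ofReal (modifiedPower q (deriv f x / f x) * f x ^ 2)]
  simp only [deriv_comp_neg, neg_div, modifiedPower_neg]

theorem boltzmannEntropy_comp_neg (V g : ℝ → ℝ) :
    boltzmannEntropy (gibbsMeasure fun x => V (-x)) (fun x => g (-x)) =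
      boltzmannEntropy (gibbsMeasure V) g := by
  have hmp := measurePreserving_neg_gibbsMeasure V
  have hemb := (MeasurableEquiv.neg ℝ).measurableEmbedding
  have hintegral (u : ℝ → ℝ) :
      ∫ x, u (-x) ∂gibbsMeasure (fun x => V (-x)) = ∫ x, u x ∂gibbsMeasure V :=
    hmp.integral_comp hemb u
  have hintegrable : Integrable (fun x => g (-x) * Real.log (1 + g (-x)))
      (gibbsMeasure fun x => V (-x)) ↔
      Integrable (fun x => g x * Real.log (1 + g x)) (gibbsMeasure V) :=
    hmp.integrable_comp_emb hemb (g := fun x => g x * Real.log (1 + g x))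
  classical
  simp only [boltzmannEntropy, hintegrable, hintegral fun x => g x * Real.log (g x), hintegral g]

end Reflection

/-! ### Domination of functionals -/

/-- The functional `F` is bounded on `s` by a finite multiple of the functional `G`. -/
def DominatedOn {α : Type*} (s : Set α) (F G : α → ℝ≥0∞) : Prop :=
  ∃ T : ℝ≥0, ∀ f ∈ s, F f ≤ T * G f

namespace DominatedOn

variable {α : Type*} {s t : Set α} {F F' G H : α → ℝ≥0∞}

theorem of_le (h : ∀ f ∈ s, F f ≤ G f) : DominatedOn s F G := ⟨1, by simpa using h⟩

theorem of_le_mul {T : ℝ≥0∞} (hT : T ≠ ⊤) (h : ∀ f ∈ s, F f ≤ T * G f) : DominatedOn s F G :=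
  ⟨T.toNNReal, by simpa only [ENNReal.coe_toNNReal hT] using h⟩

theorem of_ne_top (T : ℝ≥0) (h : ∀ f ∈ s, G f ≠ ⊤ → F f ≤ T * G f) : DominatedOn s F G := by
  refine ⟨T + 1, fun f hf => ?_⟩
  rcases eq_or_ne (G f) ⊤ with htop | hfin
  · rw [htop, ENNReal.mul_top (by simp)]
    exact le_top
  · exact (h f hf hfin).trans (by gcongr; simp)

theorem mono_set (h : DominatedOn t F G) (hst : s ⊆ t) : DominatedOn s F G :=
  let ⟨T, hT⟩ := h; ⟨T, fun f hf => hT f (hst hf)⟩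

theorem trans (hFG : DominatedOn s F G) (hGH : DominatedOn s G H) : DominatedOn s F H := by
  obtain ⟨T, hT⟩ := hFG
  obtain ⟨T', hT'⟩ := hGH
  refine ⟨T * T', fun f hf => (hT f hf).trans ?_⟩
  rw [ENNReal.coe_mul, mul_assoc]
  gcongr
  exact hT' f hf

theorem mono_left (hFG : DominatedOn s F G) (h : ∀ f ∈ s, F' f ≤ F f) : DominatedOn s F' G :=
  (of_le h).trans hFG

theorem const_mul (hFG : DominatedOn s F G) (T : ℝ≥0∞) (hT : T ≠ ⊤ := by finiteness) :
    DominatedOn s (fun f => T * F f) G :=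
  (of_le_mul hT fun _ _ => le_rfl).trans hFG

theorem add (hF : DominatedOn s F G) (hF' : DominatedOn s F' G) :
    DominatedOn s (fun f => F f + F' f) G := by
  obtain ⟨T, hT⟩ := hF
  obtain ⟨T', hT'⟩ := hF'
  refine ⟨T + T', fun f hf => ?_⟩
  rw [ENNReal.coe_add, add_mul]
  exact add_le_add (hT f hf) (hT' f hf)

end DominatedOn

/-! ### The Poincaré inequality -/

section Poincare

/-- The Dirichlet form `∫ f'² dμ`. -/
noncomputable def dirichletEnergy (μ : Measure ℝ) (f : ℝ → ℝ) : ℝ≥0∞ :=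
  ∫⁻ x, ENNReal.ofReal (deriv f x ^ 2) ∂μ

theorem dirichletEnergy_comp_neg (V f : ℝ → ℝ) :
    dirichletEnergy (gibbsMeasure fun x => V (-x)) (fun x => f (-x)) =
      dirichletEnergy (gibbsMeasure V) f := by
  rw [dirichletEnergy, dirichletEnergy,
    ← lintegral_gibbsMeasure_comp_neg V fun x => ENNReal.ofReal (deriv f x ^ 2)]
  simp only [deriv_comp_neg, neg_sq]

theorem dirichletEnergy_le_modifiedEnergy (q : ℝ) (V f : ℝ → ℝ) :
    dirichletEnergy (gibbsMeasure V) f ≤ modifiedEnergy q (gibbsMeasure V) f := by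
  refine lintegral_mono_ae (ae_gibbsMeasure ?_)
  filter_upwards [ae_deriv_eq_zero_of_eq_zero f] with x hx
  refine ENNReal.ofReal_le_ofReal ?_
  rcases eq_or_ne (f x) 0 with h | h
  · simp [hx h, h]
  · calc deriv f x ^ 2 = (deriv f x / f x) ^ 2 * f x ^ 2 := by field
      _ ≤ _ := by gcongr; exact sq_le_modifiedPower q _

theorem dominatedOn_dirichletEnergy (q : ℝ) (V : ℝ → ℝ) (s : Set (ℝ → ℝ)) :
    DominatedOn s (dirichletEnergy (gibbsMeasure V)) (modifiedEnergy q (gibbsMeasure V)) :=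
  .of_le fun f _ => dirichletEnergy_le_modifiedEnergy q V f

theorem lintegral_le_Icc_add_Ioi_add_Iio (μ : Measure ℝ) (g : ℝ → ℝ≥0∞) (R : ℝ) :
    ∫⁻ x, g x ∂μ ≤ ∫⁻ x in Icc (-R) R, g x ∂μ + ∫⁻ x in Ioi R, g x ∂μ +
      ∫⁻ x in Iio (-R), g x ∂μ := by
  have hcover : Icc (-R) R ∪ Ioi R ∪ Iio (-R) = univ := by
    ext x
    simp only [mem_union, mem_Icc, mem_Ioi, mem_Iio, mem_univ, iff_true]
    grind
  rw [← setLIntegral_univ, ← hcover]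
  exact (lintegral_union_le _ _ _).trans (by gcongr; exact lintegral_union_le _ _ _)

theorem ofReal_sub_sq_le_two_mul_add (x y z : ℝ) :
    ENNReal.ofReal ((x - z) ^ 2) ≤
      2 * ENNReal.ofReal ((x - y) ^ 2) + 2 * ENNReal.ofReal ((y - z) ^ 2) := by
  rw [← mul_add, ← ENNReal.ofReal_add (by positivity) (by positivity), ← ENNReal.ofReal_ofNat,
    ← ENNReal.ofReal_mul zero_le_two]
  exact ENNReal.ofReal_le_ofReal (by linarith [sq_nonneg (x - y - (y - z))])

theorem setLIntegral_sub_sq_le {α : Type*} {_ : MeasurableSpace α} (μ : Measure α)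
    [IsProbabilityMeasure μ] (s : Set α) (f : α → ℝ) (a b : ℝ) :
    ∫⁻ x in s, ENNReal.ofReal ((f x - b) ^ 2) ∂μ ≤
      2 * ∫⁻ x in s, ENNReal.ofReal ((f x - a) ^ 2) ∂μ + 2 * ENNReal.ofReal ((a - b) ^ 2) := by
  calc ∫⁻ x in s, ENNReal.ofReal ((f x - b) ^ 2) ∂μ
    _ ≤ ∫⁻ x in s, (2 * ENNReal.ofReal ((f x - a) ^ 2) + 2 * ENNReal.ofReal ((a - b) ^ 2)) ∂μ :=
      lintegral_mono fun x => ofReal_sub_sq_le_two_mul_add _ _ _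
    _ = 2 * ∫⁻ x in s, ENNReal.ofReal ((f x - a) ^ 2) ∂μ +
          2 * ENNReal.ofReal ((a - b) ^ 2) * μ s := by
      rw [lintegral_add_right _ measurable_const, lintegral_const_mul' _ _ ENNReal.ofNat_ne_top,
        setLIntegral_const]
    _ ≤ _ := add_le_add le_rfl (mul_le_of_le_one_right' prob_le_one)

end Poincare

/-- A potential with regular tails at `±∞` which is bounded above in between. The left tail of `V`
is the right tail of `x ↦ V (-x)`. -/
structure HasRegularTails (V : ℝ → ℝ) (R c θ : ℝ) : Prop where
  nonneg : 0 ≤ R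
  right : IsRegularTail V R c θ
  left : IsRegularTail (fun x => V (-x)) R c θ
  bddAbove : BddAbove (V '' Icc (-R) R)

namespace HasRegularTails

variable {V : ℝ → ℝ} {R c θ : ℝ}

theorem reflect (h : HasRegularTails V R c θ) : HasRegularTails (fun x => V (-x)) R c θ where
  nonneg := h.nonneg
  right := h.left
  left := by simpa using h.right
  bddAbove := by
    have himage : (fun x => V (-x)) '' Icc (-R) R = V '' Icc (-R) R := by
      rw [show (fun x => V (-x)) = V ∘ Neg.neg from rfl, image_comp, image_neg_eq_neg, neg_Icc,
        neg_neg]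
    exact himage ▸ h.bddAbove

theorem dominatedOn_iSup_sub_sq (h : HasRegularTails V R c θ) (hV : AEMeasurable V volume) :
    DominatedOn {f | LocallyLipschitz f}
      (fun f => ⨆ x ∈ Icc (-R) R, ENNReal.ofReal ((f x - f R) ^ 2))
      (dirichletEnergy (gibbsMeasure V)) := by
  obtain ⟨B, hB⟩ := h.bddAbove
  have hdensity {x : ℝ} (hx : x ∈ Icc (-R) R) :
      1 ≤ ENNReal.ofReal (Real.exp B) * ENNReal.ofReal (Real.exp (-V x)) := by
    rw [← ENNReal.ofReal_mul (Real.exp_nonneg _), ← Real.exp_add, ENNReal.one_le_ofReal]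
    exact Real.one_le_exp (by linarith [hB (mem_image_of_mem V hx)])
  refine .of_le_mul (ENNReal.mul_ne_top ENNReal.ofReal_ne_top ENNReal.ofReal_ne_top)
    (T := ENNReal.ofReal (R - -R) * ENNReal.ofReal (Real.exp B)) fun f hf =>
    iSup₂_le fun x hx => ?_
  rw [mul_assoc]
  refine (ofReal_sub_sq_le_mul_lintegral_deriv_sq hf hx
    ⟨neg_le_self h.nonneg, le_rfl⟩).trans (mul_le_mul_right ?_ _)
  calc ∫⁻ x in Icc (-R) R, ENNReal.ofReal (deriv f x ^ 2)
    _ ≤ ∫⁻ x in Icc (-R) R, ENNReal.ofReal (Real.exp B) *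
          (ENNReal.ofReal (deriv f x ^ 2) * ENNReal.ofReal (Real.exp (-V x))) := by
        refine setLIntegral_mono' measurableSet_Icc fun x hx => ?_
        rw [mul_left_comm]
        exact le_mul_of_one_le_right' (hdensity hx)
    _ = ENNReal.ofReal (Real.exp B) *
          ∫⁻ x in Icc (-R) R, ENNReal.ofReal (deriv f x ^ 2) ∂gibbsMeasure V := by
        rw [lintegral_const_mul' _ _ ENNReal.ofReal_ne_top,
          setLIntegral_gibbsMeasure hV _ measurableSet_Icc]
    _ ≤ _ := by gcongr; exact setLIntegral_le_lintegral _ _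

theorem dominatedOn_setLIntegral_Ioi_sub_sq (h : HasRegularTails V R c θ)
    (hV : AEMeasurable V volume) :
    DominatedOn {f | LocallyLipschitz f}
      (fun f => ∫⁻ x in Ioi R, ENNReal.ofReal ((f x - f R) ^ 2) ∂gibbsMeasure V)
      (dirichletEnergy (gibbsMeasure V)) :=
  .of_le_mul ENNReal.ofReal_ne_top fun _ hf => (h.right.lintegral_sub_sq_le hV hf).trans
    (mul_le_mul_right (setLIntegral_le_lintegral _ _) _)

theorem dominatedOn_setLIntegral_Iio_sub_sq (h : HasRegularTails V R c θ)
    (hV : AEMeasurable V volume) :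
    DominatedOn {f | LocallyLipschitz f}
      (fun f => ∫⁻ x in Iio (-R), ENNReal.ofReal ((f x - f (-R)) ^ 2) ∂gibbsMeasure V)
      (dirichletEnergy (gibbsMeasure V)) := by
  obtain ⟨T, hT⟩ := h.reflect.dominatedOn_setLIntegral_Ioi_sub_sq (aemeasurable_comp_neg hV)
  refine ⟨T, fun f hf => ?_⟩
  beta_reduce
  rw [← setLIntegral_Ioi_gibbsMeasure_comp_neg V fun x => ENNReal.ofReal ((f x - f (-R)) ^ 2),
    ← dirichletEnergy_comp_neg]
  exact hT (fun x => f (-x)) (locallyLipschitz_comp_neg hf)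

theorem dominatedOn_lintegral_sub_sq (h : HasRegularTails V R c θ) (hV : AEMeasurable V volume)
    [IsProbabilityMeasure (gibbsMeasure V)] :
    DominatedOn {f | LocallyLipschitz f}
      (fun f => ∫⁻ x, ENNReal.ofReal ((f x - f R) ^ 2) ∂gibbsMeasure V)
      (dirichletEnergy (gibbsMeasure V)) := by
  have hcore := h.dominatedOn_iSup_sub_sq hV
  have hleft := ((h.dominatedOn_setLIntegral_Iio_sub_sq hV).const_mul 2).add
    (hcore.const_mul 2)
  refine ((hcore.add (h.dominatedOn_setLIntegral_Ioi_sub_sq hV)).add hleft).mono_left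
    fun f _ => (lintegral_le_Icc_add_Ioi_add_Iio _ _ R).trans ?_
  have hmem : -R ∈ Icc (-R) R := ⟨le_rfl, neg_le_self h.nonneg⟩
  gcongr
  · refine (setLIntegral_mono' measurableSet_Icc fun x hx =>
      le_iSup₂ (f := fun x _ => ENNReal.ofReal ((f x - f R) ^ 2)) x hx).trans ?_
    rw [setLIntegral_const]
    exact mul_le_of_le_one_right' prob_le_one
  · refine (setLIntegral_sub_sq_le _ _ f (f (-R)) (f R)).trans ?_
    gcongr
    exact le_iSup₂ (f := fun x _ => ENNReal.ofReal ((f x - f R) ^ 2)) (-R) hmem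

end HasRegularTails

/-! ### Normalised functions -/

section Normalised

/-- The locally Lipschitz functions of norm one in `L²(μ)`. -/
def unitLocallyLipschitz (μ : Measure ℝ) : Set (ℝ → ℝ) :=
  {f | LocallyLipschitz f ∧ ∫⁻ x, ENNReal.ofReal (f x ^ 2) ∂μ = 1}

theorem unitLocallyLipschitz_subset (μ : Measure ℝ) :
    unitLocallyLipschitz μ ⊆ {f | LocallyLipschitz f} :=
  fun _ hf => hf.1

theorem comp_neg_mem_unitLocallyLipschitz {V f : ℝ → ℝ}
    (hf : f ∈ unitLocallyLipschitz (gibbsMeasure V)) :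
    (fun x => f (-x)) ∈ unitLocallyLipschitz (gibbsMeasure fun x => V (-x)) :=
  ⟨locallyLipschitz_comp_neg hf.1,
    (lintegral_gibbsMeasure_comp_neg V fun x => ENNReal.ofReal (f x ^ 2)).trans hf.2⟩

theorem ofReal_abs_sub_one_sq_le_lintegral {α : Type*} {_ : MeasurableSpace α} {μ : Measure α}
    [IsProbabilityMeasure μ] {f : α → ℝ} (hf : Measurable f)
    (hf1 : ∫⁻ x, ENNReal.ofReal (f x ^ 2) ∂μ = 1) (b : ℝ) :
    ENNReal.ofReal ((|b| - 1) ^ 2) ≤ ∫⁻ x, ENNReal.ofReal ((f x - b) ^ 2) ∂μ := by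
  have hpointwise (x : α) : ENNReal.ofReal (f x ^ 2) + ENNReal.ofReal (b ^ 2) ≤
      ENNReal.ofReal ((f x - b) ^ 2) +
        (ENNReal.ofReal |b| * ENNReal.ofReal (f x ^ 2) + ENNReal.ofReal |b|) := by
    rw [← ENNReal.ofReal_mul (abs_nonneg b), ← ENNReal.ofReal_add (by positivity) (by positivity),
      ← ENNReal.ofReal_add (by positivity) (by positivity),
      ← ENNReal.ofReal_add (by positivity) (by positivity)]
    refine ENNReal.ofReal_le_ofReal ?_
    have hyoung : 2 * |b| * |f x| ≤ |b| * (f x ^ 2 + 1) := by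
      rw [← sq_abs (f x)]
      nlinarith [abs_nonneg b, sq_nonneg (|f x| - 1)]
    linarith [le_abs_self (b * f x), abs_mul b (f x)]
  have hint := lintegral_mono (μ := μ) hpointwise
  rw [lintegral_add_right _ measurable_const, lintegral_add_left (by fun_prop),
    lintegral_add_right _ measurable_const, lintegral_const_mul' _ _ ENNReal.ofReal_ne_top, hf1,
    lintegral_const, lintegral_const, measure_univ, mul_one, mul_one] at hint
  refine (ENNReal.add_le_add_iff_right (a := ENNReal.ofReal |b| + ENNReal.ofReal |b|)
    (by finiteness)).1 (le_of_eq_of_le ?_ hint)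
  rw [← ENNReal.ofReal_one, ← ENNReal.ofReal_add (by positivity) (by positivity),
    ← ENNReal.ofReal_add (by positivity) (by positivity),
    ← ENNReal.ofReal_add (by positivity) (by positivity), ← sq_abs b]
  ring_nf

theorem ofReal_abs_sub_one_sq_le (x y : ℝ) :
    ENNReal.ofReal ((|x| - 1) ^ 2) ≤
      2 * ENNReal.ofReal ((x - y) ^ 2) + 2 * ENNReal.ofReal ((|y| - 1) ^ 2) := by
  refine (ofReal_sub_sq_le_two_mul_add |x| |y| 1).trans ?_
  gcongr 2 * ENNReal.ofReal ?_ + _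
  exact sq_le_sq.2 (abs_abs_sub_abs_le_abs_sub x y)

end Normalised

namespace HasRegularTails

variable {V : ℝ → ℝ} {R c θ : ℝ} [IsProbabilityMeasure (gibbsMeasure V)]

theorem dominatedOn_abs_sub_one_sq (h : HasRegularTails V R c θ) (hV : AEMeasurable V volume) :
    DominatedOn (unitLocallyLipschitz (gibbsMeasure V))
      (fun f => ENNReal.ofReal ((|f R| - 1) ^ 2)) (dirichletEnergy (gibbsMeasure V)) :=
  ((h.dominatedOn_lintegral_sub_sq hV).mono_set (unitLocallyLipschitz_subset _)).mono_left
    fun f hf => ofReal_abs_sub_one_sq_le_lintegral hf.1.continuous.measurable hf.2 (f R)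

theorem dominatedOn_iSup_abs_sub_one_sq (h : HasRegularTails V R c θ)
    (hV : AEMeasurable V volume) :
    DominatedOn (unitLocallyLipschitz (gibbsMeasure V))
      (fun f => ⨆ x ∈ Icc (-R) R, ENNReal.ofReal ((|f x| - 1) ^ 2))
      (dirichletEnergy (gibbsMeasure V)) := by
  have hsup := (h.dominatedOn_iSup_sub_sq hV).mono_set
    (unitLocallyLipschitz_subset (gibbsMeasure V))
  refine ((hsup.const_mul 2).add
    ((h.dominatedOn_abs_sub_one_sq hV).const_mul 2)).mono_left
    fun f _ => iSup₂_le fun x hx => (ofReal_abs_sub_one_sq_le (f x) (f R)).trans ?_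
  gcongr
  exact le_iSup₂ (f := fun x _ => ENNReal.ofReal ((f x - f R) ^ 2)) x hx

theorem dominatedOn_lintegral_abs_sub_one_sq (h : HasRegularTails V R c θ)
    (hV : AEMeasurable V volume) :
    DominatedOn (unitLocallyLipschitz (gibbsMeasure V))
      (fun f => ∫⁻ x, ENNReal.ofReal ((|f x| - 1) ^ 2) ∂gibbsMeasure V)
      (dirichletEnergy (gibbsMeasure V)) := by
  have hsub := (h.dominatedOn_lintegral_sub_sq hV).mono_set
    (unitLocallyLipschitz_subset (gibbsMeasure V))
  refine ((hsub.const_mul 2).add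
    ((h.dominatedOn_abs_sub_one_sq hV).const_mul 2)).mono_left
    fun f _ => (lintegral_mono fun x => ofReal_abs_sub_one_sq_le (f x) (f R)).trans_eq ?_
  rw [lintegral_add_right _ measurable_const, lintegral_const_mul' _ _ ENNReal.ofNat_ne_top,
    lintegral_const, measure_univ, mul_one]

theorem dominatedOn_setLIntegral_flatWeight_mul (h : HasRegularTails V R c θ)
    (hV : AEMeasurable V volume) {q C : ℝ} (hq : 1 ≤ q) (hC : 0 ≤ C)
    (hVq : ∀ x, R ≤ x → V x ≤ C * deriv V x ^ q) {m : ℕ} (hm : q ≤ 2 * m) :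
    DominatedOn (unitLocallyLipschitz (gibbsMeasure V))
      (fun f => ∫⁻ x in Ioi R, ENNReal.ofReal (flatWeight m (f x) * V x) ∂gibbsMeasure V)
      (modifiedEnergy q (gibbsMeasure V)) := by
  have hm0 : m ≠ 0 := by rintro rfl; norm_num at hm; linarith
  have hle (s : ℝ) : ENNReal.ofReal (flatWeight m s) ≤ 2 * ENNReal.ofReal ((|s| - 1) ^ 2) := by
    rw [← ENNReal.ofReal_ofNat, ← ENNReal.ofReal_mul zero_le_two]
    exact ENNReal.ofReal_le_ofReal (flatWeight_le hm0 s)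
  have henergy := dominatedOn_dirichletEnergy q V (unitLocallyLipschitz (gibbsMeasure V))
  have hboundary := (((h.dominatedOn_abs_sub_one_sq hV).trans henergy).const_mul 2).mono_left
    (F' := fun f => ENNReal.ofReal (flatWeight m (f R))) fun f _ => hle (f R)
  have hmass := (((h.dominatedOn_lintegral_abs_sub_one_sq hV).trans henergy).const_mul 2).mono_left
    (F' := fun f => ∫⁻ x, ENNReal.ofReal (flatWeight m (f x)) ∂gibbsMeasure V) fun f _ =>
      (lintegral_mono fun x => hle (f x)).trans_eq (lintegral_const_mul' _ _ ENNReal.ofNat_ne_top)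
  have hconst : 0 ≤ 2 / (1 - θ) * (V R / deriv V R) * Real.exp (-V R) := by
    have := h.right.lt_one
    have := h.right.nonneg R le_rfl
    have := h.right.deriv_pos le_rfl
    have : 0 < 1 - θ := by linarith
    positivity
  have hself : DominatedOn (unitLocallyLipschitz (gibbsMeasure V))
      (modifiedEnergy q (gibbsMeasure V)) (modifiedEnergy q (gibbsMeasure V)) :=
    .of_le fun _ _ => le_rfl
  refine ((hboundary.const_mul
    (ENNReal.ofReal (2 / (1 - θ) * (V R / deriv V R) * Real.exp (-V R)))).add
    ((hmass.const_mul (ENNReal.ofReal (2 / (1 - θ)))).add (hself.const_mul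
    (ENNReal.ofReal (((2 + 8 * m) * C ^ (1 / q) / ((1 - θ) / 2)) ^ q))))).mono_left fun f hf => ?_
  rw [← ENNReal.ofReal_mul hconst]
  exact h.right.setLIntegral_flatWeight_mul_le hV hq hm hC hVq hf.1

end HasRegularTails

/-! ### The entropy of normalised functions -/

section Entropy

open InformationTheory

theorem klFun_sq_le_of_abs_lt_two {s : ℝ} (hs : |s| < 2) :
    klFun (s ^ 2) ≤ 5 * (|s| - 1) ^ 2 := by
  rw [klFun_apply, ← sq_abs s, Real.log_pow]
  push_cast
  rcases (abs_nonneg s).eq_or_lt with hzero | hpos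
  · rw [← hzero]
    norm_num
  · have hlog : |s| ^ 2 * (2 * Real.log |s|) ≤ |s| ^ 2 * (2 * (|s| - 1)) := by
      gcongr
      exact Real.log_le_sub_one_of_pos hpos
    linarith [mul_nonneg (sq_nonneg (|s| - 1)) (by linarith : 0 ≤ 2 - |s|)]

theorem klFun_sq_le_of_two_le_abs {s v M : ℝ} (hs : 2 ≤ |s|) (hv : 0 ≤ v)
    (hM : s ^ 2 * Real.exp (-v) ≤ 2 + M) (m : ℕ) :
    klFun (s ^ 2) ≤ (|s| - 1) ^ 2 + M * s ^ 2 + (5 / 3) ^ (2 * m) * (flatWeight m s * v) := by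
  have hpos : 0 < s ^ 2 := by rw [← sq_abs]; positivity
  have hlog : Real.log (s ^ 2) ≤ s ^ 2 * Real.exp (-v) - 1 + v := by
    have := Real.log_le_sub_one_of_pos (mul_pos hpos (Real.exp_pos (-v)))
    rw [Real.log_mul hpos.ne' (Real.exp_ne_zero _), Real.log_exp] at this
    linarith
  calc klFun (s ^ 2) = s ^ 2 * Real.log (s ^ 2) + 1 - s ^ 2 := klFun_apply _
    _ ≤ s ^ 2 * (1 + M + v) + 1 - s ^ 2 := by gcongr; linarith
    _ = 1 + M * s ^ 2 + s ^ 2 * v := by ring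
    _ ≤ (|s| - 1) ^ 2 + M * s ^ 2 + (5 / 3) ^ (2 * m) * flatWeight m s * v := by
        gcongr
        · nlinarith
        · exact sq_le_mul_flatWeight m hs
    _ = _ := by rw [mul_assoc ((5 / 3) ^ (2 * m))]

theorem ofReal_klFun_sq_le {s v : ℝ} {M : ℝ≥0∞} (hv : 0 ≤ v)
    (hM : ENNReal.ofReal (s ^ 2 * Real.exp (-v)) ≤ 2 + M) (m : ℕ) :
    ENNReal.ofReal (klFun (s ^ 2)) ≤ 5 * ENNReal.ofReal ((|s| - 1) ^ 2) +
      M * ENNReal.ofReal (s ^ 2) +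
      ENNReal.ofReal ((5 / 3) ^ (2 * m)) * ENNReal.ofReal (flatWeight m s * v) := by
  have hweight := mul_nonneg (flatWeight_nonneg m s) hv
  rw [← ENNReal.ofReal_ofNat 5, ← ENNReal.ofReal_mul (by positivity),
    ← ENNReal.ofReal_mul (by positivity : (0 : ℝ) ≤ (5 / 3) ^ (2 * m))]
  rcases lt_or_ge |s| 2 with hs | hs
  · exact (ENNReal.ofReal_le_ofReal (klFun_sq_le_of_abs_lt_two hs)).trans
      (le_self_add.trans le_self_add)
  have hpos : 0 < s ^ 2 := by rw [← sq_abs]; positivity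
  induction M with
  | top =>
    rw [ENNReal.top_mul (ENNReal.ofReal_pos.2 hpos).ne', add_top, top_add]
    exact le_top
  | coe M =>
    have hM' : s ^ 2 * Real.exp (-v) ≤ 2 + M := by
      rw [← ENNReal.ofReal_ofNat, ← ENNReal.ofReal_coe_nnreal,
        ← ENNReal.ofReal_add (by positivity) (by positivity)] at hM
      exact (ENNReal.ofReal_le_ofReal_iff (by positivity)).1 hM
    rw [← ENNReal.ofReal_coe_nnreal, ← ENNReal.ofReal_mul (by positivity),
      ← ENNReal.ofReal_add (by positivity) (by positivity),
      ← ENNReal.ofReal_add (by positivity) (by positivity)]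
    refine ENNReal.ofReal_le_ofReal ((klFun_sq_le_of_two_le_abs hs hv hM' m).trans ?_)
    gcongr
    linarith [sq_nonneg (|s| - 1)]

theorem setLIntegral_klFun_sq_le {α : Type*} {_ : MeasurableSpace α} {μ : Measure α} {s : Set α}
    (hs : MeasurableSet s) {f v : α → ℝ} (hf : Measurable f)
    (hf1 : ∫⁻ x, ENNReal.ofReal (f x ^ 2) ∂μ = 1) (hv : ∀ x ∈ s, 0 ≤ v x) {M : ℝ≥0∞}
    (hM : ∀ x ∈ s, ENNReal.ofReal (f x ^ 2 * Real.exp (-v x)) ≤ 2 + M) (m : ℕ) :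
    ∫⁻ x in s, ENNReal.ofReal (klFun (f x ^ 2)) ∂μ ≤
      5 * ∫⁻ x, ENNReal.ofReal ((|f x| - 1) ^ 2) ∂μ + M +
        ENNReal.ofReal ((5 / 3) ^ (2 * m)) *
          ∫⁻ x in s, ENNReal.ofReal (flatWeight m (f x) * v x) ∂μ := by
  refine (setLIntegral_mono' hs fun x hx => ofReal_klFun_sq_le (hv x hx) (hM x hx) m).trans ?_
  rw [lintegral_add_left (by fun_prop), lintegral_add_left (by fun_prop),
    lintegral_const_mul' _ _ ENNReal.ofNat_ne_top, lintegral_const_mul _ (by fun_prop),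
    lintegral_const_mul' _ _ ENNReal.ofReal_ne_top]
  gcongr
  · exact Measure.restrict_le_self
  · exact mul_le_of_le_one_right' ((setLIntegral_le_lintegral _ _).trans_eq hf1)

theorem ofReal_sq_le_two_add (s : ℝ) :
    ENNReal.ofReal (s ^ 2) ≤ 2 + 2 * ENNReal.ofReal ((|s| - 1) ^ 2) := by
  have := ofReal_sub_sq_le_two_mul_add |s| 1 0
  rwa [sub_zero, sq_abs, sub_zero, one_pow, ENNReal.ofReal_one, mul_one, add_comm] at this

end Entropy

namespace HasRegularTails

open InformationTheory

variable {V : ℝ → ℝ} {R c θ q C : ℝ} [IsProbabilityMeasure (gibbsMeasure V)]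

theorem dominatedOn_setLIntegral_Icc_klFun_sq (h : HasRegularTails V R c θ)
    (hV : AEMeasurable V volume) :
    DominatedOn (unitLocallyLipschitz (gibbsMeasure V))
      (fun f => ∫⁻ x in Icc (-R) R, ENNReal.ofReal (klFun (f x ^ 2)) ∂gibbsMeasure V)
      (dirichletEnergy (gibbsMeasure V)) := by
  refine (((h.dominatedOn_lintegral_abs_sub_one_sq hV).const_mul 5).add
    ((h.dominatedOn_iSup_abs_sub_one_sq hV).const_mul 2)).mono_left fun f hf => ?_
  refine (setLIntegral_klFun_sq_le measurableSet_Icc hf.1.continuous.measurable hf.2 (v := 0)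
    (M := 2 * ⨆ x ∈ Icc (-R) R, ENNReal.ofReal ((|f x| - 1) ^ 2)) (fun _ _ => le_rfl)
    (fun x hx => ?_) 0).trans_eq (by simp)
  rw [Pi.zero_apply, neg_zero, Real.exp_zero, mul_one]
  refine (ofReal_sq_le_two_add (f x)).trans ?_
  gcongr
  exact le_iSup₂ (f := fun x _ => ENNReal.ofReal ((|f x| - 1) ^ 2)) x hx

theorem dominatedOn_setLIntegral_Ioi_klFun_sq (h : HasRegularTails V R c θ)
    (hV : AEMeasurable V volume) (hq : 1 ≤ q) (hC : 0 ≤ C)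
    (hVq : ∀ x, R ≤ x → V x ≤ C * deriv V x ^ q) :
    DominatedOn (unitLocallyLipschitz (gibbsMeasure V))
      (fun f => ∫⁻ x in Ioi R, ENNReal.ofReal (klFun (f x ^ 2)) ∂gibbsMeasure V)
      (modifiedEnergy q (gibbsMeasure V)) := by
  have henergy := dominatedOn_dirichletEnergy q V (unitLocallyLipschitz (gibbsMeasure V))
  have hm : q ≤ 2 * ⌈q⌉₊ := by linarith [Nat.le_ceil q]
  have hmass := ((h.dominatedOn_lintegral_abs_sub_one_sq hV).trans henergy).const_mul 5
  have hpointwise := (((h.dominatedOn_abs_sub_one_sq hV).trans henergy).const_mul 2).add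
    (henergy.const_mul (ENNReal.ofReal (1 / c)))
  have hweight := (h.dominatedOn_setLIntegral_flatWeight_mul hV hq hC hVq hm).const_mul
    (ENNReal.ofReal ((5 / 3) ^ (2 * ⌈q⌉₊)))
  refine ((hmass.add hpointwise).add hweight).mono_left fun f hf => ?_
  refine setLIntegral_klFun_sq_le measurableSet_Ioi hf.1.continuous.measurable hf.2
    (fun x hx => h.right.nonneg x (le_of_lt hx)) (fun x hx => ?_) _
  refine (h.right.ofReal_sq_mul_exp_neg_le hV hf.1 (le_of_lt hx)).trans ?_
  rw [← add_assoc]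
  gcongr
  · refine (ENNReal.ofReal_le_ofReal ?_).trans (ofReal_sq_le_two_add (f R))
    exact mul_le_of_le_one_right (sq_nonneg _)
      (Real.exp_le_one_iff.2 (neg_nonpos.2 (h.right.nonneg R le_rfl)))
  · exact setLIntegral_le_lintegral _ _

theorem dominatedOn_setLIntegral_Iio_klFun_sq (h : HasRegularTails V R c θ)
    (hV : AEMeasurable V volume) (hq : 1 ≤ q) (hC : 0 ≤ C)
    (hVq : ∀ x, R ≤ x → V (-x) ≤ C * deriv (fun x => V (-x)) x ^ q) :
    DominatedOn (unitLocallyLipschitz (gibbsMeasure V))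
      (fun f => ∫⁻ x in Iio (-R), ENNReal.ofReal (klFun (f x ^ 2)) ∂gibbsMeasure V)
      (modifiedEnergy q (gibbsMeasure V)) := by
  have := isProbabilityMeasure_gibbsMeasure_comp_neg (V := V) inferInstance
  obtain ⟨T, hT⟩ :=
    h.reflect.dominatedOn_setLIntegral_Ioi_klFun_sq (aemeasurable_comp_neg hV) hq hC hVq
  refine ⟨T, fun f hf => ?_⟩
  beta_reduce
  rw [← setLIntegral_Ioi_gibbsMeasure_comp_neg V fun x => ENNReal.ofReal (klFun (f x ^ 2)),
    ← modifiedEnergy_comp_neg]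
  exact hT _ (comp_neg_mem_unitLocallyLipschitz hf)

theorem dominatedOn_lintegral_klFun_sq (h : HasRegularTails V R c θ)
    (hV : AEMeasurable V volume) (hq : 1 ≤ q) (hC : 0 ≤ C)
    (hright : ∀ x, R ≤ x → V x ≤ C * deriv V x ^ q)
    (hleft : ∀ x, R ≤ x → V (-x) ≤ C * deriv (fun x => V (-x)) x ^ q) :
    DominatedOn (unitLocallyLipschitz (gibbsMeasure V))
      (fun f => ∫⁻ x, ENNReal.ofReal (klFun (f x ^ 2)) ∂gibbsMeasure V)
      (modifiedEnergy q (gibbsMeasure V)) :=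
  ((((h.dominatedOn_setLIntegral_Icc_klFun_sq hV).trans (dominatedOn_dirichletEnergy q V _)).add
    (h.dominatedOn_setLIntegral_Ioi_klFun_sq hV hq hC hright)).add
    (h.dominatedOn_setLIntegral_Iio_klFun_sq hV hq hC hleft)).mono_left
    fun _ _ => lintegral_le_Icc_add_Ioi_add_Iio _ _ R

end HasRegularTails

/-! ### Sufficiency -/

section Sufficiency

open InformationTheory

variable {μ : Measure ℝ} {g : ℝ → ℝ}

theorem mul_log_le_mul_log_one_add {x : ℝ} (hx : 0 ≤ x) :
    x * Real.log x ≤ x * Real.log (1 + x) := by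
  rcases hx.eq_or_lt with rfl | hpos
  · simp
  · gcongr
    linarith

theorem mul_log_one_add_le {x : ℝ} (hx : 0 ≤ x) :
    x * Real.log (1 + x) ≤ x * Real.log x + 1 := by
  rcases hx.eq_or_lt with rfl | hpos
  · norm_num
  · have hfactor : Real.log (1 + x) = Real.log x + Real.log (1 + x⁻¹) := by
      rw [← Real.log_mul hpos.ne' (by positivity), mul_add, mul_one,
        mul_inv_cancel₀ hpos.ne', add_comm]
    have hlog : x * Real.log (1 + x⁻¹) ≤ x * x⁻¹ := by
      gcongr
      linarith [Real.log_le_sub_one_of_pos (by positivity : 0 < 1 + x⁻¹)]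
    rw [mul_inv_cancel₀ hpos.ne'] at hlog
    linarith [congrArg (x * ·) hfactor]

theorem integrable_mul_log_one_add_iff [IsFiniteMeasure μ] (hg : Measurable g)
    (hg0 : ∀ x, 0 ≤ g x) :
    Integrable (fun x => g x * Real.log (1 + g x)) μ ↔
      Integrable (fun x => g x * Real.log (g x)) μ := by
  have hdiff : Integrable (fun x => g x * Real.log (1 + g x) - g x * Real.log (g x)) μ := by
    refine (integrable_const 1).mono' (by fun_prop) (ae_of_all _ fun x => ?_)
    rw [Real.norm_of_nonneg (sub_nonneg.2 (mul_log_le_mul_log_one_add (hg0 x)))]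
    linarith [mul_log_one_add_le (hg0 x)]
  refine ⟨fun h => ?_, fun h => ?_⟩
  · exact (h.sub hdiff).congr (.of_forall fun x => sub_sub_cancel _ _)
  · exact (h.add hdiff).congr (.of_forall fun x => add_sub_cancel _ _)

theorem boltzmannEntropy_eq_zero_of_ae_eq_zero (hg : g =ᵐ[μ] 0) : boltzmannEntropy μ g = 0 := by
  have hmul (k : ℝ → ℝ) : (fun x => g x * k (g x)) =ᵐ[μ] 0 := by
    filter_upwards [hg] with x hx
    simp [hx]
  rw [boltzmannEntropy, if_pos ((integrable_congr (hmul fun t => Real.log (1 + t))).2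
    (integrable_zero _ _ _)), integral_eq_zero_of_ae (hmul Real.log), integral_eq_zero_of_ae hg]
  simp

theorem mul_log_eq_klFun {N : ℝ} (hN : N ≠ 0) (x : ℝ) :
    x * Real.log x = N * klFun (N⁻¹ * x) + (1 + Real.log N) * x - N := by
  rcases eq_or_ne x 0 with rfl | hx
  · simp [klFun_zero]
  · rw [klFun_apply, Real.log_mul (inv_ne_zero hN) hx, Real.log_inv]
    field

theorem boltzmannEntropy_le_mul_lintegral_klFun [IsProbabilityMeasure μ] (hg : Measurable g)
    (hg0 : ∀ x, 0 ≤ g x) (hint : Integrable g μ) (hpos : 0 < ∫ x, g x ∂μ) :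
    boltzmannEntropy μ g ≤ ENNReal.ofReal (∫ x, g x ∂μ) *
      ∫⁻ x, ENNReal.ofReal (klFun ((∫ y, g y ∂μ)⁻¹ * g x)) ∂μ := by
  set N := ∫ x, g x ∂μ with hN
  have hkl0 (x : ℝ) : 0 ≤ klFun (N⁻¹ * g x) :=
    klFun_nonneg (mul_nonneg (inv_nonneg.2 hpos.le) (hg0 x))
  rcases eq_or_ne (∫⁻ x, ENNReal.ofReal (klFun (N⁻¹ * g x)) ∂μ) ⊤ with htop | hfin
  · rw [htop, ENNReal.mul_top (ENNReal.ofReal_pos.2 hpos).ne']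
    exact le_top
  have hkl : Integrable (fun x => klFun (N⁻¹ * g x)) μ :=
    (lintegral_ofReal_ne_top_iff_integrable
      (measurable_klFun.comp (hg.const_mul _)).aestronglyMeasurable (ae_of_all _ hkl0)).1 hfin
  have hsum : Integrable (fun x => N * klFun (N⁻¹ * g x) + (1 + Real.log N) * g x) μ :=
    (hkl.const_mul N).add (hint.const_mul _)
  have hlog : Integrable (fun x => g x * Real.log (g x)) μ := by
    simp only [mul_log_eq_klFun hpos.ne']
    exact hsum.sub (integrable_const N)
  have hvalue : ∫ x, g x * Real.log (g x) ∂μ =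
      N * ∫ x, klFun (N⁻¹ * g x) ∂μ + (1 + Real.log N) * N - N := by
    simp only [mul_log_eq_klFun hpos.ne']
    rw [integral_sub hsum (integrable_const N), integral_add (hkl.const_mul N)
      (hint.const_mul _), integral_const_mul, integral_const_mul, ← hN]
    simp
  rw [boltzmannEntropy, if_pos ((integrable_mul_log_one_add_iff hg hg0).2 hlog), hvalue, ← hN,
    ← ofReal_integral_eq_lintegral_ofReal hkl (ae_of_all _ hkl0), ← ENNReal.ofReal_mul hpos.le]
  exact ENNReal.ofReal_le_ofReal (by linarith)

theorem modifiedEnergy_const_mul (q : ℝ) (μ : Measure ℝ) {a : ℝ} (ha : a ≠ 0) (f : ℝ → ℝ) :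
    modifiedEnergy q μ (fun x => a * f x) = ENNReal.ofReal (a ^ 2) * modifiedEnergy q μ f := by
  rw [modifiedEnergy, modifiedEnergy, ← lintegral_const_mul' _ _ ENNReal.ofReal_ne_top]
  refine lintegral_congr fun x => ?_
  rw [← ENNReal.ofReal_mul (sq_nonneg a), deriv_const_mul_field, mul_div_mul_left _ _ ha]
  ring_nf

theorem exists_mem_unitLocallyLipschitz {μ : Measure ℝ} {f : ℝ → ℝ} (hf : LocallyLipschitz f)
    (hint : Integrable (fun x => f x ^ 2) μ) (hpos : 0 < ∫ x, f x ^ 2 ∂μ) :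
    ∃ a ≠ 0, a ^ 2 = (∫ x, f x ^ 2 ∂μ)⁻¹ ∧ (fun x => a * f x) ∈ unitLocallyLipschitz μ := by
  have hsq : (√(∫ x, f x ^ 2 ∂μ)⁻¹) ^ 2 = (∫ x, f x ^ 2 ∂μ)⁻¹ := Real.sq_sqrt (by positivity)
  refine ⟨√(∫ x, f x ^ 2 ∂μ)⁻¹, by positivity, hsq,
    locallyLipschitz_contDiff_comp (g := fun s => _ * s) (by fun_prop) hf, ?_⟩
  simp only [mul_pow, hsq]
  rw [← ofReal_integral_eq_lintegral_ofReal (hint.const_mul _) (ae_of_all _ fun x => by positivity),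
    integral_const_mul, inv_mul_cancel₀ hpos.ne', ENNReal.ofReal_one]

end Sufficiency

namespace HasRegularTails

open InformationTheory

variable {V : ℝ → ℝ} {R c θ q C : ℝ} [IsProbabilityMeasure (gibbsMeasure V)]

theorem integrable_sq (h : HasRegularTails V R c θ) (hV : AEMeasurable V volume) {f : ℝ → ℝ}
    (hf : LocallyLipschitz f) (hE : modifiedEnergy q (gibbsMeasure V) f ≠ ⊤) :
    Integrable (fun x => f x ^ 2) (gibbsMeasure V) := by
  have hfm := hf.continuous.measurable
  obtain ⟨T, hT⟩ := (h.dominatedOn_lintegral_sub_sq hV).trans (dominatedOn_dirichletEnergy q V _)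
  have hsub : MemLp (fun x => f x - f R) 2 (gibbsMeasure V) := by
    refine (memLp_two_iff_integrable_sq (by fun_prop)).2
      ((lintegral_ofReal_ne_top_iff_integrable (by fun_prop)
        (ae_of_all _ fun x => sq_nonneg _)).1 ?_)
    exact ne_top_of_le_ne_top (ENNReal.mul_ne_top ENNReal.coe_ne_top hE) (hT f hf)
  simpa using (hsub.add (memLp_const (f R))).integrable_sq

theorem dominatedOn_boltzmannEntropy_sq (h : HasRegularTails V R c θ) (hV : AEMeasurable V volume)
    (hq : 1 ≤ q) (hC : 0 ≤ C) (hright : ∀ x, R ≤ x → V x ≤ C * deriv V x ^ q)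
    (hleft : ∀ x, R ≤ x → V (-x) ≤ C * deriv (fun x => V (-x)) x ^ q) :
    DominatedOn {f | LocallyLipschitz f}
      (fun f => boltzmannEntropy (gibbsMeasure V) fun x => f x ^ 2)
      (modifiedEnergy q (gibbsMeasure V)) := by
  obtain ⟨T, hT⟩ := h.dominatedOn_lintegral_klFun_sq hV hq hC hright hleft
  refine .of_ne_top T fun f hf hE => ?_
  have hint := h.integrable_sq hV hf hE
  set N := ∫ x, f x ^ 2 ∂gibbsMeasure V
  rcases (integral_nonneg fun x => sq_nonneg (f x) : 0 ≤ N).eq_or_lt with hN | hN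
  · rw [boltzmannEntropy_eq_zero_of_ae_eq_zero
      ((integral_eq_zero_iff_of_nonneg (fun x => sq_nonneg _) hint).1 hN.symm)]
    exact zero_le
  obtain ⟨a, ha, hasq, hunit⟩ := exists_mem_unitLocallyLipschitz hf hint hN
  calc boltzmannEntropy (gibbsMeasure V) (fun x => f x ^ 2)
    _ ≤ ENNReal.ofReal N * ∫⁻ x, ENNReal.ofReal (klFun ((a * f x) ^ 2)) ∂gibbsMeasure V := by
        simp only [mul_pow, hasq]
        exact boltzmannEntropy_le_mul_lintegral_klFun (hf.continuous.measurable.pow_const 2)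
          (fun x => sq_nonneg _) hint hN
    _ ≤ ENNReal.ofReal N * (T * (ENNReal.ofReal (a ^ 2) *
          modifiedEnergy q (gibbsMeasure V) f)) := by
        rw [← modifiedEnergy_const_mul q _ ha]
        gcongr
        exact hT _ hunit
    _ = T * modifiedEnergy q (gibbsMeasure V) f := by
        rw [mul_left_comm, ← mul_assoc (ENNReal.ofReal N), ← ENNReal.ofReal_mul hN.le, hasq,
          mul_inv_cancel₀ hN.ne', ENNReal.ofReal_one, one_mul]

end HasRegularTails

/-! ### Necessity -/

section Necessity

theorem integrable_of_integrable_mul_log_one_add {μ : Measure ℝ} [IsFiniteMeasure μ] {g : ℝ → ℝ}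
    (hg : Measurable g) (hg0 : ∀ x, 0 ≤ g x)
    (h : Integrable (fun x => g x * Real.log (1 + g x)) μ) : Integrable g μ := by
  refine (h.add (integrable_const (Real.exp 1))).mono' hg.aestronglyMeasurable
    (ae_of_all _ fun x => ?_)
  rw [Real.norm_of_nonneg (hg0 x), Pi.add_apply]
  rcases le_total (g x) (Real.exp 1) with hle | hge
  · linarith [mul_nonneg (hg0 x) (Real.log_nonneg (by linarith [hg0 x] : 1 ≤ 1 + g x))]
  · have hlog : 1 ≤ Real.log (1 + g x) := by
      rw [Real.le_log_iff_exp_le (by linarith [hg0 x])]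
      linarith
    linarith [le_mul_of_one_le_right (hg0 x) hlog, Real.exp_pos 1]

theorem integral_mul_log_sub_log_measureReal_le {μ : Measure ℝ} [IsFiniteMeasure μ] {g : ℝ → ℝ}
    {s : Set ℝ} (hg0 : ∀ x, 0 ≤ g x) (hgs : ∀ x ∉ s, g x = 0) (hint : Integrable g μ)
    (hlog : Integrable (fun x => g x * Real.log (g x)) μ) :
    (∫ x, g x ∂μ) * (Real.log (∫ x, g x ∂μ) - Real.log (μ.real s)) ≤
      ∫ x, g x * Real.log (g x) ∂μ := by
  have hint_eq : ∫ x in s, g x ∂μ = ∫ x, g x ∂μ :=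
    setIntegral_eq_integral_of_forall_compl_eq_zero hgs
  have hlog_eq : ∫ x in s, g x * Real.log (g x) ∂μ = ∫ x, g x * Real.log (g x) ∂μ :=
    setIntegral_eq_integral_of_forall_compl_eq_zero fun x hx => by simp [hgs x hx]
  rcases eq_or_ne (μ s) 0 with hs | hs
  · rw [← hint_eq, ← hlog_eq, setIntegral_measure_zero _ hs, setIntegral_measure_zero _ hs,
      zero_mul]
  rcases eq_or_ne (∫ x, g x ∂μ) 0 with hzero | hne
  · have hae := (integral_eq_zero_iff_of_nonneg hg0 hint).1 hzero
    rw [hzero, zero_mul, integral_eq_zero_of_ae]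
    filter_upwards [hae] with x hx
    simp [hx]
  have hM : 0 < μ.real s := ENNReal.toReal_pos hs (measure_ne_top μ s)
  have jensen := Real.convexOn_mul_log.map_set_average_le Real.continuous_mul_log.continuousOn
    isClosed_Ici hs (measure_ne_top μ s) (ae_of_all _ hg0) hint.integrableOn hlog.integrableOn
  rw [setAverage_eq, setAverage_eq, hint_eq, hlog_eq, smul_eq_mul, smul_eq_mul, mul_assoc,
    Real.log_mul (inv_ne_zero hM.ne') hne, Real.log_inv] at jensen
  linarith [le_of_mul_le_mul_left jensen (inv_pos.2 hM)]

theorem ofReal_integral_mul_neg_log_measureReal_le_boltzmannEntropy {μ : Measure ℝ}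
    [IsFiniteMeasure μ] {g : ℝ → ℝ} {s : Set ℝ} (hg : Measurable g) (hg0 : ∀ x, 0 ≤ g x)
    (hgs : ∀ x ∉ s, g x = 0) :
    ENNReal.ofReal ((∫ x, g x ∂μ) * -Real.log (μ.real s)) ≤ boltzmannEntropy μ g := by
  rw [boltzmannEntropy]
  split_ifs with h
  · refine ENNReal.ofReal_le_ofReal ?_
    linarith [integral_mul_log_sub_log_measureReal_le hg0 hgs
      (integrable_of_integrable_mul_log_one_add hg hg0 h)
      ((integrable_mul_log_one_add_iff hg hg0).1 h)]
  · exact le_top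

theorem modifiedPower_div_mul_sq_le {q w : ℝ} {m : ℕ} (hm0 : m ≠ 0) (hm : q ≤ 2 * m)
    (hw : 0 < w) (hw1 : w ≤ 1) (t : ℝ) :
    modifiedPower q (t / w) * (w ^ m) ^ 2 ≤ modifiedPower q t := by
  have hpow : w ^ m / w ≤ 1 := div_le_one_of_le₀ (pow_le_of_le_one hw.le hw1 hm0) hw.le
  have hrpow : (w ^ m) ^ 2 / w ^ q ≤ 1 := by
    refine div_le_one_of_le₀ ?_ (by positivity)
    rw [← pow_mul, ← Real.rpow_natCast]
    exact Real.rpow_le_rpow_of_exponent_ge hw hw1 (by push_cast; linarith)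
  rw [modifiedPower, max_mul_of_nonneg _ _ (by positivity)]
  refine max_le ?_ ?_
  · calc (t / w) ^ 2 * (w ^ m) ^ 2 = t ^ 2 * (w ^ m / w) ^ 2 := by ring
      _ ≤ t ^ 2 := mul_le_of_le_one_right (sq_nonneg t) (pow_le_one₀ (by positivity) hpow)
      _ ≤ modifiedPower q t := sq_le_modifiedPower q t
  · calc |t / w| ^ q * (w ^ m) ^ 2 = |t| ^ q * ((w ^ m) ^ 2 / w ^ q) := by
          rw [abs_div, abs_of_pos hw, Real.div_rpow (abs_nonneg t) hw.le]
          ring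
      _ ≤ |t| ^ q := mul_le_of_le_one_right (by positivity) hrpow
      _ ≤ modifiedPower q t := rpow_le_modifiedPower q t

theorem modifiedPower_le_mul_rpow_mul {q c k A t : ℝ} (hq : 2 ≤ q) (hc : 0 < c) (hcA : c ≤ A)
    (hk : 0 ≤ k) (ht : 0 ≤ t) (htA : t ≤ k * A) :
    modifiedPower q t ≤ (k * c ^ (2 - q) + k ^ (q - 1)) * A ^ (q - 1) * t := by
  have hA := hc.trans_le hcA
  have hslope : A ≤ c ^ (2 - q) * A ^ (q - 1) := by
    calc A = A ^ (2 - q) * A ^ (q - 1) := by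
          rw [← Real.rpow_add hA, sub_add_sub_cancel]
          norm_num
      _ ≤ _ := mul_le_mul_of_nonneg_right
          (Real.rpow_le_rpow_of_nonpos hc hcA (by linarith)) (by positivity)
  have hsq : t ^ 2 ≤ k * c ^ (2 - q) * A ^ (q - 1) * t := by
    calc t ^ 2 = t * t := sq t
      _ ≤ k * (c ^ (2 - q) * A ^ (q - 1)) * t := by gcongr; exact htA.trans (by gcongr)
      _ = _ := by ring
  have hrpow : |t| ^ q ≤ k ^ (q - 1) * A ^ (q - 1) * t := by
    calc |t| ^ q = t ^ (q - 1) * t := by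
          rw [abs_of_nonneg ht, ← Real.rpow_add_one' ht (by linarith), sub_add_cancel]
      _ ≤ (k * A) ^ (q - 1) * t := by gcongr; linarith
      _ = _ := by rw [Real.mul_rpow hk hA.le]
  have : 0 ≤ k * c ^ (2 - q) * A ^ (q - 1) * t := by positivity
  have : 0 ≤ k ^ (q - 1) * A ^ (q - 1) * t := by positivity
  refine max_le ?_ ?_ <;> linarith

end Necessity

/-- The test function `min (V - V a) 1 ^ m` on `[a, ∞)`, extended by zero to the left of `a`. For
`2m ≥ q` the factor `f²` in the energy compensates the singularity of `f'/f` at `a`. -/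
noncomputable def tailTest (V : ℝ → ℝ) (a : ℝ) (m : ℕ) (y : ℝ) : ℝ :=
  min (V (max y a) - V a) 1 ^ m

theorem tailTest_of_le {V : ℝ → ℝ} {a y : ℝ} {m : ℕ} (hm : m ≠ 0) (hy : y ≤ a) :
    tailTest V a m y = 0 := by
  simp [tailTest, max_eq_right hy, hm]

namespace IsRegularTail

variable {V : ℝ → ℝ} {R c θ q : ℝ} {m : ℕ}

theorem deriv_le (h : IsRegularTail V R c θ) {x : ℝ} (hx : R ≤ x) :
    deriv V x ≤ Real.exp (V x - V R) * deriv V R := by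
  have hderiv (y : ℝ) (hy : R ≤ y) : HasDerivAt (fun y => deriv V y * Real.exp (-V y))
      ((deriv (deriv V) y - deriv V y ^ 2) * Real.exp (-V y)) y := by
    convert! (h.hasDerivAt_deriv hy).mul (h.hasDerivAt_exp_neg hy) using 1
    ring
  have hanti : AntitoneOn (fun y => deriv V y * Real.exp (-V y)) (Ici R) := by
    refine antitoneOn_of_hasDerivWithinAt_nonpos (convex_Ici R)
      (fun y hy => (hderiv y hy).continuousAt.continuousWithinAt)
      (fun y hy => (hderiv y (interior_subset hy)).hasDerivWithinAt) fun y hy => ?_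
    refine mul_nonpos_of_nonpos_of_nonneg (sub_nonpos.2 ?_) (Real.exp_nonneg _)
    calc deriv (deriv V) y ≤ θ * deriv V y ^ 2 :=
          (le_abs_self _).trans (h.abs_deriv_deriv_le y (interior_subset hy))
      _ ≤ deriv V y ^ 2 := mul_le_of_le_one_left (sq_nonneg _) h.lt_one.le
  calc deriv V x = deriv V x * Real.exp (-V x) * Real.exp (V x) := by
        rw [mul_assoc, ← Real.exp_add, neg_add_cancel, Real.exp_zero, mul_one]
    _ ≤ deriv V R * Real.exp (-V R) * Real.exp (V x) :=
        mul_le_mul_of_nonneg_right (hanti self_mem_Ici hx hx) (Real.exp_nonneg _)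
    _ = Real.exp (V x - V R) * deriv V R := by
        rw [sub_eq_neg_add, Real.exp_add]
        ring

theorem exists_eq_add (h : IsRegularTail V R c θ) {t : ℝ} (ht : 0 ≤ t) :
    ∃ b, R ≤ b ∧ V b = V R + t := by
  have hle : R ≤ R + t / c := le_add_of_nonneg_right (div_nonneg ht h.pos.le)
  have hgrowth : c * (R + t / c - R) ≤ V (R + t / c) - V R := by
    refine (convex_Ici R).mul_sub_le_image_sub_of_le_deriv h.continuousOn ?_ ?_ R self_mem_Ici _
      hle hle <;> intro x hx
    exacts [(h.hasDerivAt (interior_subset hx)).differentiableAt.differentiableWithinAt,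
      h.le_deriv x (interior_subset hx)]
  rw [add_sub_cancel_left, mul_div_cancel₀ _ h.pos.ne'] at hgrowth
  obtain ⟨b, hb, hVb⟩ := intermediate_value_Icc hle (h.continuousOn.mono Icc_subset_Ici_self)
    (⟨by linarith, by linarith⟩ : V R + t ∈ Icc (V R) (V (R + t / c)))
  exact ⟨b, hb.1, hVb⟩

theorem ae_ne (h : IsRegularTail V R c θ) (t : ℝ) : ∀ᵐ x, R ≤ x → V x ≠ t := by
  filter_upwards [ae_deriv_eq_zero_of_eq_zero fun x => V x - t] with x hx hRx heq
  rw [deriv_sub_const] at hx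
  exact (h.deriv_pos hRx).ne' (hx (sub_eq_zero.2 heq))

theorem locallyLipschitz_tailTest (h : IsRegularTail V R c θ) (m : ℕ) :
    LocallyLipschitz (tailTest V R m) := by
  have hVmax : LocallyLipschitz fun y => V (max y R) := by
    intro y
    obtain ⟨K, t, ht, hK⟩ := ((h.contDiffAt (le_max_right y R)).of_le
      one_le_two).exists_lipschitzOnWith
    have hmax : LipschitzWith 1 fun y : ℝ => max y R := LipschitzWith.id.max_const R
    exact ⟨K * 1, _, hmax.continuous.continuousAt.preimage_mem_nhds ht,
      hK.comp hmax.lipschitzOnWith fun z hz => hz⟩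
  have hmin : LocallyLipschitz fun z : ℝ => min z 1 :=
    (LipschitzWith.id.min_const 1).locallyLipschitz
  exact locallyLipschitz_contDiff_comp (g := fun s => s ^ m) (by fun_prop)
    (hmin.comp (hVmax.sub (.const (V R))))

theorem tailTest_mem_Icc (h : IsRegularTail V R c θ) (m : ℕ) (y : ℝ) :
    tailTest V R m y ∈ Icc 0 1 := by
  have hmono : V R ≤ V (max y R) :=
    h.strictMonoOn.monotoneOn self_mem_Ici (le_max_right y R) (le_max_right y R)
  have hnonneg : 0 ≤ min (V (max y R) - V R) 1 := le_min (sub_nonneg.2 hmono) zero_le_one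
  exact ⟨pow_nonneg hnonneg m, pow_le_one₀ hnonneg (min_le_right _ _)⟩

theorem tailTest_of_one_le {x : ℝ} (hx : R ≤ x) (hVx : 1 ≤ V x - V R) (m : ℕ) :
    tailTest V R m x = 1 := by
  rw [tailTest, max_eq_left hx, min_eq_right hVx, one_pow]

theorem tailTest_of_le_one {x : ℝ} (hx : R ≤ x) (hVx : V x - V R ≤ 1) (m : ℕ) :
    tailTest V R m x = (V x - V R) ^ m := by
  rw [tailTest, max_eq_left hx, min_eq_left hVx]

theorem deriv_tailTest (h : IsRegularTail V R c θ) {x : ℝ} (hx : R < x) (hVx : V x - V R < 1) :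
    deriv (tailTest V R m) x = m * (V x - V R) ^ (m - 1) * deriv V x := by
  have hV := (h.hasDerivAt hx.le).sub_const (V R)
  rw [← (hV.fun_pow m).deriv]
  refine EventuallyEq.deriv_eq ?_
  filter_upwards [Ioi_mem_nhds hx, hV.continuousAt.eventually_lt_const hVx] with y hy hVy
  exact tailTest_of_le_one (le_of_lt hy) hVy.le m

theorem deriv_tailTest_eq_zero (h : IsRegularTail V R c θ) {x : ℝ} (hx : R < x)
    (hVx : 1 < V x - V R) : deriv (tailTest V R m) x = 0 := by
  have hV := (h.hasDerivAt hx.le).sub_const (V R)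
  rw [← deriv_const x 1]
  refine EventuallyEq.deriv_eq ?_
  filter_upwards [Ioi_mem_nhds hx, hV.continuousAt.eventually_const_lt hVx] with y hy hVy
  exact tailTest_of_one_le (le_of_lt hy) hVy.le m

theorem modifiedPower_tailTest_le (h : IsRegularTail V R c θ) (hm0 : m ≠ 0) (hm : q ≤ 2 * m)
    {x : ℝ} (hx : R < x) (hVx : V x - V R < 1) :
    modifiedPower q (deriv (tailTest V R m) x / tailTest V R m x) * tailTest V R m x ^ 2 ≤
      modifiedPower q (m * deriv V x) := by
  have hpos : 0 < V x - V R := sub_pos.2 (h.strictMonoOn self_mem_Ici hx.le hx)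
  have hlogDeriv : m * (V x - V R) ^ (m - 1) * deriv V x / (V x - V R) ^ m =
      m * deriv V x / (V x - V R) := by
    rw [← mul_pow_sub_one hm0 (V x - V R)]
    field
  rw [h.deriv_tailTest hx hVx, tailTest_of_le_one hx.le hVx.le, hlogDeriv]
  exact modifiedPower_div_mul_sq_le hm0 hm hpos hVx.le _

theorem modifiedPower_tailTest_le_mul (h : IsRegularTail V R c θ) (hm0 : m ≠ 0) (hm : q ≤ 2 * m)
    (hq : q ≠ 0) {L : ℝ}
    (hL : ∀ t, 0 ≤ t → t ≤ m * Real.exp 1 * deriv V R → modifiedPower q t ≤ L * t)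
    {x : ℝ} (hx : R < x) (hVx : V x ≠ V R + 1) :
    modifiedPower q (deriv (tailTest V R m) x / tailTest V R m x) * tailTest V R m x ^ 2 ≤
      L * m * deriv V x := by
  have hnonneg : 0 ≤ m * deriv V x := mul_nonneg m.cast_nonneg (h.deriv_pos hx.le).le
  rw [mul_assoc L]
  rcases lt_or_gt_of_ne hVx with hlt | hgt
  · refine (h.modifiedPower_tailTest_le hm0 hm hx (by linarith)).trans (hL _ hnonneg ?_)
    rw [mul_assoc]
    gcongr
    refine (h.deriv_le hx.le).trans ?_
    gcongr
    exacts [(h.deriv_pos le_rfl).le, by linarith]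
  · have hzero : modifiedPower q 0 = 0 := by simp [modifiedPower, Real.zero_rpow hq]
    have hL0 : 0 ≤ L := by
      have hR := h.deriv_pos le_rfl
      exact nonneg_of_mul_nonneg_left ((modifiedPower_nonneg q _).trans
        (hL _ (by positivity) le_rfl)) (by positivity)
    rw [h.deriv_tailTest_eq_zero hx (by linarith), zero_div, hzero, zero_mul]
    exact mul_nonneg hL0 hnonneg

theorem modifiedEnergy_tailTest_le (h : IsRegularTail V R c θ) (hV : AEMeasurable V volume)
    (hm0 : m ≠ 0) (hm : q ≤ 2 * m) (hq : q ≠ 0) {L : ℝ}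
    (hL : ∀ t, 0 ≤ t → t ≤ m * Real.exp 1 * deriv V R → modifiedPower q t ≤ L * t) :
    modifiedEnergy q (gibbsMeasure V) (tailTest V R m) ≤
      ENNReal.ofReal (L * m * Real.exp (-V R)) := by
  calc modifiedEnergy q (gibbsMeasure V) (tailTest V R m)
    _ ≤ ∫⁻ x, (Ioi R).indicator (fun x => ENNReal.ofReal (L * m) * ENNReal.ofReal (deriv V x)) x
          ∂gibbsMeasure V := by
        refine lintegral_mono_ae (ae_gibbsMeasure ?_)
        filter_upwards [h.ae_ne (V R + 1)] with x hx
        rcases le_or_gt x R with hle | hRx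
        · simp [tailTest_of_le hm0 hle]
        · rw [indicator_of_mem (mem_Ioi.2 hRx), ← ENNReal.ofReal_mul' (h.deriv_pos hRx.le).le]
          exact ENNReal.ofReal_le_ofReal
            (h.modifiedPower_tailTest_le_mul hm0 hm hq hL hRx (hx hRx.le))
    _ = ENNReal.ofReal (L * m) *
          ∫⁻ x in Ioi R, ENNReal.ofReal (deriv V x) ∂gibbsMeasure V := by
        rw [lintegral_indicator measurableSet_Ioi, lintegral_const_mul' _ _ ENNReal.ofReal_ne_top]
    _ ≤ ENNReal.ofReal (L * m) * ENNReal.ofReal (Real.exp (-V R)) := by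
        gcongr
        exact h.lintegral_deriv_le hV
    _ = _ := (ENNReal.ofReal_mul' (Real.exp_nonneg _)).symm

theorem measureReal_Ioi_le (h : IsRegularTail V R c θ) (hV : AEMeasurable V volume) :
    c * (gibbsMeasure V).real (Ioi R) ≤ Real.exp (-V R) := by
  have := ENNReal.toReal_le_of_le_ofReal (Real.exp_nonneg _) (h.mul_gibbsMeasure_Ioi_le hV)
  rwa [ENNReal.toReal_mul, ENNReal.toReal_ofReal h.pos.le] at this

theorem le_measureReal_Ioi [IsFiniteMeasure (gibbsMeasure V)] (h : IsRegularTail V R c θ)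
    (hV : AEMeasurable V volume) :
    (1 - Real.exp (-1)) * Real.exp (-V R) ≤
      Real.exp 1 * deriv V R * (gibbsMeasure V).real (Ioi R) := by
  have hR := h.deriv_pos le_rfl
  obtain ⟨b, hb, hVb⟩ := h.exists_eq_add zero_le_one
  have hexp : Real.exp (-V R) - Real.exp (-V b) = (1 - Real.exp (-1)) * Real.exp (-V R) := by
    rw [hVb, neg_add, Real.exp_add]
    ring
  have hexp0 : 0 ≤ (1 - Real.exp (-1)) * Real.exp (-V R) :=
    mul_nonneg (sub_nonneg.2 (Real.exp_le_one_iff.2 (by norm_num))) (Real.exp_nonneg _)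
  have hmass := ofReal_add_setLIntegral_Ioc_gibbsMeasure_le hV hb (w := 0)
    (F := fun x => Real.exp (-V R) - Real.exp (-V x)) (u := fun _ => Real.exp 1 * deriv V R)
    ((locallyLipschitz_absolutelyContinuousOnInterval (.const _) R b).sub
      (h.absolutelyContinuousOnInterval_exp_neg hb)) (hexp ▸ hexp0) aemeasurable_const
    (fun _ _ => by positivity) (fun _ _ => le_rfl) (.of_forall fun x hx => ?_)
  · simp only [Pi.zero_apply, ENNReal.ofReal_zero, lintegral_zero, add_zero, sub_self, zero_add,
      setLIntegral_const, hexp] at hmass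
    rw [← ENNReal.ofReal_le_ofReal_iff (by positivity), ENNReal.ofReal_mul
      (p := Real.exp 1 * deriv V R) (by positivity), ofReal_measureReal]
    exact hmass.trans (by gcongr; exact Ioc_subset_Ioi_self)
  · rw [((h.hasDerivAt_exp_neg hx.1).const_sub _).deriv, Pi.zero_apply, zero_mul, add_zero,
      neg_mul, neg_neg]
    gcongr
    refine (h.deriv_le hx.1).trans ?_
    gcongr
    linarith [h.strictMonoOn.monotoneOn hx.1 hb hx.2]

theorem le_integral_tailTest_sq [IsFiniteMeasure (gibbsMeasure V)] (h : IsRegularTail V R c θ)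
    (hV : AEMeasurable V volume) (m : ℕ) :
    (1 - Real.exp (-1)) * Real.exp (-3) * Real.exp (-V R) ≤
      deriv V R * ∫ x, tailTest V R m x ^ 2 ∂gibbsMeasure V := by
  obtain ⟨b, hb, hVb⟩ := h.exists_eq_add zero_le_one
  have hslope : deriv V b ≤ Real.exp 1 * deriv V R := by
    simpa [hVb] using h.deriv_le hb
  have hmass : (gibbsMeasure V).real (Ioi b) ≤ ∫ x, tailTest V R m x ^ 2 ∂gibbsMeasure V := by
    have hone (x : ℝ) (hx : x ∈ Ioi b) : tailTest V R m x = 1 := by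
      refine tailTest_of_one_le (hb.trans (le_of_lt hx)) ?_ m
      linarith [h.strictMonoOn hb (hb.trans (le_of_lt hx)) hx]
    have hint : Integrable (fun x => tailTest V R m x ^ 2) (gibbsMeasure V) :=
      .of_bound ((h.locallyLipschitz_tailTest m).continuous.pow 2).aestronglyMeasurable 1
        (ae_of_all _ fun x => by
          rw [Real.norm_of_nonneg (sq_nonneg _)]
          exact pow_le_one₀ (h.tailTest_mem_Icc m x).1 (h.tailTest_mem_Icc m x).2)
    refine le_trans (le_of_eq ?_) (setIntegral_le_integral (s := Ioi b) hint
      (ae_of_all _ fun x => sq_nonneg _))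
    rw [setIntegral_congr_fun measurableSet_Ioi fun x hx => by rw [hone x hx, one_pow]]
    simp
  have hlower := (h.mono hb).le_measureReal_Ioi hV
  have hR := h.deriv_pos le_rfl
  calc (1 - Real.exp (-1)) * Real.exp (-3) * Real.exp (-V R)
    _ = Real.exp (-2) * ((1 - Real.exp (-1)) * Real.exp (-V b)) := by
        rw [hVb, neg_add, Real.exp_add, show (-3 : ℝ) = -2 + -1 by norm_num, Real.exp_add]
        ring
    _ ≤ Real.exp (-2) * (Real.exp 1 * (Real.exp 1 * deriv V R) *
          ∫ x, tailTest V R m x ^ 2 ∂gibbsMeasure V) := by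
        exact mul_le_mul_of_nonneg_left (hlower.trans (by gcongr)) (Real.exp_nonneg _)
    _ = Real.exp (-2 + 1 + 1) * (deriv V R * ∫ x, tailTest V R m x ^ 2 ∂gibbsMeasure V) := by
        rw [Real.exp_add, Real.exp_add]
        ring
    _ = _ := by norm_num

end IsRegularTail

namespace IsRegularTail

variable {V : ℝ → ℝ} {R c θ q : ℝ} {m : ℕ} [IsFiniteMeasure (gibbsMeasure V)]

theorem add_log_le_neg_log_measureReal (h : IsRegularTail V R c θ) (hV : AEMeasurable V volume) :
    V R + Real.log c ≤ -Real.log ((gibbsMeasure V).real (Ioi R)) := by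
  have hslope := h.deriv_pos le_rfl
  have hexp : 0 < (1 - Real.exp (-1)) * Real.exp (-V R) :=
    mul_pos (sub_pos.2 (Real.exp_lt_one_iff.2 (by norm_num))) (Real.exp_pos _)
  have hmass : 0 < (gibbsMeasure V).real (Ioi R) :=
    pos_of_mul_pos_right (hexp.trans_le (h.le_measureReal_Ioi hV)) (by positivity)
  have hlog := Real.log_le_log (mul_pos h.pos hmass) (h.measureReal_Ioi_le hV)
  rw [Real.log_mul h.pos.ne' hmass.ne', Real.log_exp] at hlog
  linarith

theorem mul_add_log_le_of_boltzmannEntropy_le (h : IsRegularTail V R c θ)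
    (hV : AEMeasurable V volume) (hm0 : m ≠ 0) (hm : q ≤ 2 * m) (hq : q ≠ 0) {T : ℝ≥0}
    (hT : boltzmannEntropy (gibbsMeasure V) (fun x => tailTest V R m x ^ 2) ≤
      T * modifiedEnergy q (gibbsMeasure V) (tailTest V R m)) {L : ℝ} (hL0 : 0 ≤ L)
    (hL : ∀ t, 0 ≤ t → t ≤ m * Real.exp 1 * deriv V R → modifiedPower q t ≤ L * t) :
    (1 - Real.exp (-1)) * Real.exp (-3) * (V R + Real.log c) ≤ T * m * L * deriv V R := by
  have hR := h.deriv_pos le_rfl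
  have hlip := h.locallyLipschitz_tailTest m
  set k := (1 - Real.exp (-1)) * Real.exp (-3)
  rcases le_or_gt (V R + Real.log c) 0 with hneg | hpos
  · have hk : 0 ≤ k := mul_nonneg (sub_nonneg.2 (Real.exp_le_one_iff.2 (by norm_num)))
      (Real.exp_nonneg _)
    exact (mul_nonpos_of_nonneg_of_nonpos hk hneg).trans (by positivity)
  have hentropy : (∫ x, tailTest V R m x ^ 2 ∂gibbsMeasure V) *
      -Real.log ((gibbsMeasure V).real (Ioi R)) ≤ T * (L * m * Real.exp (-V R)) := by
    rw [← ENNReal.ofReal_le_ofReal_iff (by positivity), ENNReal.ofReal_mul T.coe_nonneg,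
      ENNReal.ofReal_coe_nnreal]
    refine (ofReal_integral_mul_neg_log_measureReal_le_boltzmannEntropy
      (hlip.continuous.measurable.pow_const 2) (fun x => sq_nonneg _) fun x hx => ?_).trans
      (hT.trans (mul_le_mul_right (h.modifiedEnergy_tailTest_le hV hm0 hm hq hL) _))
    simp [tailTest_of_le hm0 (not_lt.1 hx)]
  refine le_of_mul_le_mul_right ?_ (Real.exp_pos (-V R))
  calc k * (V R + Real.log c) * Real.exp (-V R)
    _ = k * Real.exp (-V R) * (V R + Real.log c) := by ring
    _ ≤ deriv V R * (∫ x, tailTest V R m x ^ 2 ∂gibbsMeasure V) * (V R + Real.log c) := by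
        exact mul_le_mul_of_nonneg_right (h.le_integral_tailTest_sq hV m) hpos.le
    _ ≤ deriv V R * ((∫ x, tailTest V R m x ^ 2 ∂gibbsMeasure V) *
          -Real.log ((gibbsMeasure V).real (Ioi R))) := by
        rw [mul_assoc]
        gcongr
        exact h.add_log_le_neg_log_measureReal hV
    _ ≤ deriv V R * (T * (L * m * Real.exp (-V R))) := by gcongr
    _ = T * m * L * deriv V R * Real.exp (-V R) := by ring

theorem exists_le_mul_rpow_of_dominatedOn (h : IsRegularTail V R c θ) (hV : AEMeasurable V volume)
    (hq : 2 ≤ q) (hdom : DominatedOn {f | LocallyLipschitz f}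
      (fun f => boltzmannEntropy (gibbsMeasure V) fun x => f x ^ 2)
      (modifiedEnergy q (gibbsMeasure V))) :
    ∃ C, ∀ x, R ≤ x → V x ≤ C * deriv V x ^ q := by
  obtain ⟨T, hT⟩ := hdom
  obtain ⟨m, hm⟩ : ∃ m : ℕ, q / 2 ≤ m := exists_nat_ge _
  have hm0 : m ≠ 0 := by
    rintro rfl
    norm_num at hm
    linarith
  have hc := h.pos
  set k := (1 - Real.exp (-1)) * Real.exp (-3)
  have hk : 0 < k := mul_pos (sub_pos.2 (Real.exp_lt_one_iff.2 (by norm_num))) (Real.exp_pos _)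
  set B := m * Real.exp 1 * c ^ (2 - q) + (m * Real.exp 1) ^ (q - 1)
  refine ⟨T * m * B / k + |Real.log c| * (c ^ q)⁻¹, fun x hx => ?_⟩
  have hslope := h.deriv_pos hx
  have hmain := (h.mono hx).mul_add_log_le_of_boltzmannEntropy_le hV hm0 (by linarith) (by linarith)
    (hT _ ((h.mono hx).locallyLipschitz_tailTest m)) (L := B * deriv V x ^ (q - 1)) (by positivity)
    fun t ht htle => modifiedPower_le_mul_rpow_mul hq hc (h.le_deriv x hx) (by positivity) ht htle
  have hrpow : deriv V x ^ (q - 1) * deriv V x = deriv V x ^ q := by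
    rw [← Real.rpow_add_one' hslope.le (by linarith), sub_add_cancel]
  have hle : V x + Real.log c ≤ T * m * B / k * deriv V x ^ q := by
    rw [div_mul_eq_mul_div, le_div_iff₀' hk, ← hrpow]
    linarith
  have hlog : -Real.log c ≤ |Real.log c| * (c ^ q)⁻¹ * deriv V x ^ q := by
    refine (neg_le_abs _).trans ?_
    rw [mul_assoc, inv_mul_eq_div]
    exact le_mul_of_one_le_right (abs_nonneg _) ((one_le_div (by positivity)).2
      (Real.rpow_le_rpow hc.le (h.le_deriv x hx) (by linarith)))
  rw [add_mul]
  linarith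

end IsRegularTail

/-! ### The criterion -/

theorem dominatedOn_comp_neg {V : ℝ → ℝ} {q : ℝ} (h : DominatedOn {f | LocallyLipschitz f}
      (fun f => boltzmannEntropy (gibbsMeasure V) fun x => f x ^ 2)
      (modifiedEnergy q (gibbsMeasure V))) :
    DominatedOn {f | LocallyLipschitz f}
      (fun f => boltzmannEntropy (gibbsMeasure fun x => V (-x)) fun x => f x ^ 2)
      (modifiedEnergy q (gibbsMeasure fun x => V (-x))) := by
  obtain ⟨T, hT⟩ := h
  refine ⟨T, fun f hf => ?_⟩
  simpa only [← boltzmannEntropy_comp_neg V, ← modifiedEnergy_comp_neg q V, neg_neg]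
    using hT _ (locallyLipschitz_comp_neg hf)

theorem tendsto_atTop_of_le_deriv {V : ℝ → ℝ} {c : ℝ} (hc : 0 < c)
    (hV : ∀ᶠ x in atTop, DifferentiableAt ℝ V x) (hderiv : ∀ᶠ x in atTop, c ≤ deriv V x) :
    Tendsto V atTop atTop := by
  obtain ⟨T, hT⟩ := eventually_atTop.1 (hV.and hderiv)
  have hlinear : Tendsto (fun x => c * (x - T) + V T) atTop atTop :=
    tendsto_atTop_add_const_right _ _
      ((tendsto_atTop_add_const_right _ (-T) tendsto_id).const_mul_atTop hc)
  refine tendsto_atTop_mono' _ ?_ hlinear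
  filter_upwards [eventually_ge_atTop T] with x hx
  have hmvt := (convex_Ici T).mul_sub_le_image_sub_of_le_deriv
    (fun z hz => (hT z hz).1.continuousAt.continuousWithinAt)
    (fun z hz => (hT z (interior_subset hz)).1.differentiableWithinAt)
    (fun z hz => (hT z (interior_subset hz)).2) T self_mem_Ici x hx hx
  linarith

theorem eventually_isRegularTail {V : ℝ → ℝ} {c θ : ℝ} (hc : 0 < c) (hθ : θ < 1)
    (hV : ∃ S, ContDiffOn ℝ 2 V (Ioi S)) (hderiv : ∀ᶠ x in atTop, c ≤ deriv V x)
    (hderiv2 : ∀ᶠ x in atTop, |iteratedDeriv 2 V x| ≤ θ * deriv V x ^ 2) :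
    ∀ᶠ R in atTop, IsRegularTail V R c θ := by
  obtain ⟨S, hS⟩ := hV
  have hdiff : ∀ᶠ x in atTop, DifferentiableAt ℝ V x := by
    filter_upwards [Ioi_mem_atTop S] with x hx
    exact (hS.contDiffAt (Ioi_mem_nhds hx)).differentiableAt (by norm_num)
  have hnonneg := (tendsto_atTop_of_le_deriv hc hdiff hderiv).eventually_ge_atTop 0
  filter_upwards [eventually_gt_atTop S, eventually_forall_ge_atTop.2 hnonneg,
    eventually_forall_ge_atTop.2 hderiv, eventually_forall_ge_atTop.2 hderiv2]
    with R hSR hR hR' hR''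
  simp only [iteratedDeriv_succ, iteratedDeriv_zero] at hR''
  exact ⟨hc, hθ, ⟨S, hSR, hS⟩, hR, hR', hR''⟩

theorem bddAbove_image_of_isCompact {α β : Type*} [TopologicalSpace α] [LinearOrder β] [Nonempty β]
    {f : α → β} {s : Set α} (hs : IsCompact s) (hf : ∀ x ∈ s, ∃ C, ∀ᶠ y in 𝓝[s] x, f y ≤ C) :
    BddAbove (f '' s) := by
  refine hs.induction_on (p := fun t => BddAbove (f '' t)) (by simp)
    (fun t t' h ht' => ht'.mono (image_mono h)) (fun t t' ht ht' => ?_) fun x hx => ?_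
  · rw [image_union]
    exact ht.union ht'
  · obtain ⟨C, hC⟩ := hf x hx
    exact ⟨_, hC, C, forall_mem_image.2 fun y hy => hy⟩

theorem limsup_coe_lt_top_iff {α : Type*} {l : Filter α} {u : α → ℝ} :
    limsup (fun x => (u x : EReal)) l < ⊤ ↔ ∃ C : ℝ, ∀ᶠ x in l, u x ≤ C := by
  constructor
  · intro h
    obtain ⟨C, hC, -⟩ := EReal.lt_iff_exists_real_btwn.1 h
    exact ⟨C, (eventually_lt_of_limsup_lt hC).mono fun x hx => EReal.coe_le_coe_iff.1 hx.le⟩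
  · rintro ⟨C, hC⟩
    exact (limsup_le_of_le isCobounded_le_of_bot
      (hC.mono fun x hx => EReal.coe_le_coe_iff.2 hx)).trans_lt (EReal.coe_lt_top C)

theorem eventually_cocompact_real_iff {p : ℝ → Prop} :
    (∀ᶠ x in cocompact ℝ, p x) ↔ (∀ᶠ x in atTop, p x) ∧ ∀ᶠ x in atTop, p (-x) := by
  rw [cocompact_eq_atBot_atTop, eventually_sup, and_comm, ← map_neg_atTop, eventually_map]

theorem exists_hasRegularTails {V : ℝ → ℝ} (hVbdd : ∀ x, ∃ C, ∀ᶠ y in 𝓝 x, V y ≤ C)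
    (hVsmooth : ∃ R, ContDiffOn ℝ 2 V (Ioi R) ∧ ContDiffOn ℝ 2 V (Iio (-R)))
    (hV1 : (0 : EReal) <
      liminf (fun x : ℝ => ((Real.sign x * deriv V x : ℝ) : EReal)) (cocompact ℝ))
    (hV2 : ∃ θ < 1, ∀ᶠ x in cocompact ℝ, |iteratedDeriv 2 V x| ≤ θ * deriv V x ^ 2) :
    ∃ R c θ, HasRegularTails V R c θ := by
  obtain ⟨S, hS, hS'⟩ := hVsmooth
  obtain ⟨c, hc, hcV⟩ := EReal.lt_iff_exists_real_btwn.1 hV1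
  obtain ⟨θ, hθ, hθV⟩ := hV2
  obtain ⟨hslope, hslope'⟩ := eventually_cocompact_real_iff.1 (eventually_lt_of_lt_liminf hcV)
  obtain ⟨hcurv, hcurv'⟩ := eventually_cocompact_real_iff.1 hθV
  simp only [EReal.coe_lt_coe_iff] at hslope hslope'
  have hright : ∀ᶠ R in atTop, IsRegularTail V R c θ := by
    refine eventually_isRegularTail (EReal.coe_pos.1 hc) hθ ⟨S, hS⟩ ?_ hcurv
    filter_upwards [hslope, eventually_gt_atTop 0] with x hx hx0
    rw [Real.sign_of_pos hx0, one_mul] at hx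
    exact hx.le
  have hleft : ∀ᶠ R in atTop, IsRegularTail (fun x => V (-x)) R c θ := by
    refine eventually_isRegularTail (EReal.coe_pos.1 hc) hθ
      ⟨S, hS'.comp contDiff_neg.contDiffOn fun x hx => neg_lt_neg (mem_Ioi.1 hx)⟩ ?_ ?_
    · filter_upwards [hslope', eventually_gt_atTop 0] with x hx hx0
      rw [Real.sign_of_neg (neg_lt_zero.2 hx0), neg_one_mul] at hx
      rw [deriv_comp_neg]
      exact hx.le
    · simpa [iteratedDeriv_comp_neg, deriv_comp_neg] using hcurv'
  obtain ⟨R, hr, hl, hR⟩ := (hright.and (hleft.and (eventually_ge_atTop 0))).exists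
  exact ⟨R, c, θ, hR, hr, hl, bddAbove_image_of_isCompact isCompact_Icc fun x _ =>
    (hVbdd x).imp fun _ h => eventually_nhdsWithin_of_eventually_nhds h⟩

theorem IsRegularTail.exists_le_mul_rpow_iff {V : ℝ → ℝ} {R c θ q : ℝ}
    (h : IsRegularTail V R c θ) (hq : 0 ≤ q) :
    (∃ C, ∀ x, R ≤ x → V x ≤ C * deriv V x ^ q) ↔
      ∃ C, ∀ᶠ x in atTop, V x / |deriv V x| ^ q ≤ C := by
  have hdiv {x C : ℝ} (hx : R ≤ x) : V x / |deriv V x| ^ q ≤ C ↔ V x ≤ C * deriv V x ^ q := by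
    have hslope := h.deriv_pos hx
    rw [abs_of_pos hslope, div_le_iff₀ (by positivity)]
  constructor
  · rintro ⟨C, hC⟩
    exact ⟨C, (eventually_ge_atTop R).mono fun x hx => (hdiv hx).2 (hC x hx)⟩
  · rintro ⟨C, hC⟩
    obtain ⟨T, hT⟩ := eventually_atTop.1 (hC.and (eventually_ge_atTop R))
    have hRT := (hT T le_rfl).2
    refine ⟨max C (V T / c ^ q), fun x hx => (hdiv hx).1 ?_⟩
    rcases le_total T x with hTx | hxT
    · exact le_max_of_le_left (hT x hTx).1
    · have hc := h.pos
      refine le_max_of_le_right (div_le_div₀ (h.nonneg T hRT)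
        (h.strictMonoOn.monotoneOn hx hRT hxT) (by positivity) ?_)
      exact Real.rpow_le_rpow hc.le ((h.le_deriv x hx).trans (le_abs_self _)) hq

theorem HasRegularTails.dominatedOn_iff_limsup_lt_top {V : ℝ → ℝ} {R c θ q : ℝ}
    [hprob : IsProbabilityMeasure (gibbsMeasure V)] (h : HasRegularTails V R c θ)
    (hV : AEMeasurable V volume) (hq : 2 ≤ q) :
    DominatedOn {f | LocallyLipschitz f}
      (fun f => boltzmannEntropy (gibbsMeasure V) fun x => f x ^ 2)
      (modifiedEnergy q (gibbsMeasure V)) ↔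
      limsup (fun x : ℝ => ((V x / |deriv V x| ^ q : ℝ) : EReal)) (cocompact ℝ) < ⊤ := by
  have hprob' := isProbabilityMeasure_gibbsMeasure_comp_neg hprob
  have hleft : (∃ C, ∀ x, R ≤ x → V (-x) ≤ C * deriv (fun x => V (-x)) x ^ q) ↔
      ∃ C, ∀ᶠ x in atTop, V (-x) / |deriv V (-x)| ^ q ≤ C := by
    simpa only [deriv_comp_neg, abs_neg] using h.left.exists_le_mul_rpow_iff (by linarith)
  have hsides : limsup (fun x : ℝ => ((V x / |deriv V x| ^ q : ℝ) : EReal)) (cocompact ℝ) < ⊤ ↔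
      (∃ C, ∀ x, R ≤ x → V x ≤ C * deriv V x ^ q) ∧
        ∃ C, ∀ x, R ≤ x → V (-x) ≤ C * deriv (fun x => V (-x)) x ^ q := by
    rw [hleft, h.right.exists_le_mul_rpow_iff (by linarith)]
    simp only [cocompact_eq_atBot_atTop, ← map_neg_atTop, limsup_sup_filter, sup_lt_iff, and_comm,
      limsup_coe_lt_top_iff, eventually_map]
  rw [hsides]
  constructor
  · exact fun hdom => ⟨h.right.exists_le_mul_rpow_of_dominatedOn hV hq hdom,
      h.left.exists_le_mul_rpow_of_dominatedOn (aemeasurable_comp_neg hV) hq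
        (dominatedOn_comp_neg hdom)⟩
  · rintro ⟨⟨C, hC⟩, C', hC'⟩
    have hslope (x : ℝ) (hx : R ≤ x) := Real.rpow_nonneg (h.right.deriv_pos hx).le q
    have hslope' (x : ℝ) (hx : R ≤ x) := Real.rpow_nonneg (h.left.deriv_pos hx).le q
    exact h.dominatedOn_boltzmannEntropy_sq hV (by linarith)
      (C := max 0 (max C C')) (le_max_left _ _)
      (fun x hx => (hC x hx).trans (mul_le_mul_of_nonneg_right (by simp) (hslope x hx)))
      fun x hx => (hC' x hx).trans (mul_le_mul_of_nonneg_right (by simp) (hslope' x hx))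

theorem exists_abs_iteratedDeriv_two_le {V : ℝ → ℝ} {l : Filter ℝ}
    (hV1 : (0 : EReal) < liminf (fun x : ℝ => ((Real.sign x * deriv V x : ℝ) : EReal)) l)
    (hV2 : Tendsto (fun x : ℝ => iteratedDeriv 2 V x / (deriv V x) ^ 2) l (𝓝 0)) :
    ∃ θ < 1, ∀ᶠ x in l, |iteratedDeriv 2 V x| ≤ θ * deriv V x ^ 2 := by
  have hne : ∀ᶠ x in l, deriv V x ≠ 0 :=
    (eventually_lt_of_lt_liminf hV1).mono fun x hx h => by simp [h] at hx
  have hlittle : iteratedDeriv 2 V =o[l] fun x => deriv V x ^ 2 :=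
    (Asymptotics.isLittleO_iff_tendsto' (hne.mono fun x hx h => (pow_ne_zero 2 hx h).elim)).2 hV2
  exact ⟨1 / 2, by norm_num, by simpa using hlittle.bound one_half_pos⟩

theorem mainTheorem1_general (q : ℝ) (hq : 2 ≤ q) (V : ℝ → ℝ)
    (hVmeas : AEMeasurable V volume)
    (hprob : IsProbabilityMeasure (gibbsMeasure V))
    (hVbdd : ∀ x : ℝ, ∃ C : ℝ, ∀ᶠ y in 𝓝 x, V y ≤ C)
    (hVsmooth : ∃ R : ℝ, ContDiffOn ℝ 2 V (Ioi R) ∧ ContDiffOn ℝ 2 V (Iio (-R)))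
    (hV1 : (0 : EReal) <
      liminf (fun x : ℝ => ((Real.sign x * deriv V x : ℝ) : EReal)) (cocompact ℝ))
    (hV2 : ∃ θ < 1, ∀ᶠ x in cocompact ℝ, |iteratedDeriv 2 V x| ≤ θ * deriv V x ^ 2) :
    (∃ κ : ℝ≥0, ∀ f : ℝ → ℝ, LocallyLipschitz f →
        boltzmannEntropy (gibbsMeasure V) (fun x => f x ^ 2) ≤
          (κ : ℝ≥0∞) * modifiedEnergy q (gibbsMeasure V) f) ↔
      limsup (fun x : ℝ => ((V x / |deriv V x| ^ q : ℝ) : EReal)) (cocompact ℝ) < ⊤ := by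
  obtain ⟨R, c, θ, h⟩ := exists_hasRegularTails hVbdd hVsmooth hV1 hV2
  exact h.dominatedOn_iff_limsup_lt_top hVmeas hq

theorem mainTheorem1 (q : ℝ) (hq : 2 ≤ q) (V : ℝ → ℝ)
    (hVmeas : AEMeasurable V volume)
    (hprob : IsProbabilityMeasure (gibbsMeasure V))
    (hVbdd : ∀ x : ℝ, ∃ C : ℝ, ∀ᶠ y in 𝓝 x, |V y| ≤ C)
    (hVsmooth : ∃ R : ℝ, ContDiffOn ℝ 2 V (Set.Ioi R) ∧ ContDiffOn ℝ 2 V (Set.Iio (-R)))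
    (hV1 : (0 : EReal) <
      liminf (fun x : ℝ => ((Real.sign x * deriv V x : ℝ) : EReal)) (cocompact ℝ))
    (hV2 : Tendsto (fun x : ℝ => iteratedDeriv 2 V x / (deriv V x) ^ 2) (cocompact ℝ) (𝓝 0)) :
    (∃ κ : ℝ≥0, ∀ f : ℝ → ℝ, LocallyLipschitz f →
        boltzmannEntropy (gibbsMeasure V) (fun x => f x ^ 2) ≤
          (κ : ℝ≥0∞) * modifiedEnergy q (gibbsMeasure V) f) ↔
      limsup (fun x : ℝ => ((V x / |deriv V x| ^ q : ℝ) : EReal)) (cocompact ℝ) < ⊤ :=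
  mainTheorem1_general q hq V hVmeas hprob
    (fun x => (hVbdd x).imp fun _ h => h.mono fun _ hy => (le_abs_self _).trans hy) hVsmooth hV1
    (exists_abs_iteratedDeriv_two_le hV1 hV2)
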